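/- Let $\mathbb{G}$ be a compact quantum group in the sense of Woronowicz: a unital C*-algebra $A=C(\mathbb{G})\neq 0$ with a coassociative unital $*$-homomorphism $\Delta\colon A\to A\otimes A$ (minimal tensor product) such that the linear spans of $(A\otimes 1)\Delta(A)$ and $(1\otimes A)\Delta(A)$ are dense in $A\otimes A$. A finite-dimensional unitary representation of $\mathbb{G}$ is a unitary $U\in B(H_U)\otimes A$, with $H_U$ a finite-dimensional Hilbert space, such that $(\mathrm{id}\otimes\Delta)(U)=U_{12}U_{13}$. For representations $U,V$ let $\operatorname{Mor}(U,V)$ be the space of linear maps $T\colon H_U\to H_V$ with $(T\otimes 1)U=V(T\otimes 1)$, and let $\operatorname{End}(U)=\operatorname{Mor}(U,U)$. Let $U^{\mathrm c}=(j\otimes\mathrm{id})(U^{-1})$ be the contragredient representation on $H_U^*$, where $j$ sends an operator to its dual operator, and let $\rho_U$ be the unique positive invertible element of $\operatorname{Mor}(U,U^{\mathrm{cc}})$ (with $H_U^{**}$ identified with $H_U$) such that $$\operatorname{Tr}(T\rho_U)=\operatorname{Tr}(T\rho_U^{-1})\qquad\text{for all }T\in\operatorname{End}(U).$$ For a finite-dimensional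 unitary representation $U$ and $n\in\mathbb{N}$ put $$b(U,n)=\sum_{\alpha}(\dim\alpha)^2,$$ where $\alpha$ ranges over the equivalence classes of irreducible subrepresentations of $\bigoplus_{k=0}^{n}U^{\otimes k}$. Assume that the dual $\widehat{\mathbb{G}}$ has subexponential growth, that is, $\lim_{n\to\infty}b(U,n)^{1/n}=1$ for every finite-dimensional unitary representation $U$ of $\mathbb{G}$. Then for every finite-dimensional unitary representation $U$ of $\mathbb{G}$ the operator $\rho_U$ has symmetric eigenvalues: the list of eigenvalues of $\rho_U$ and the list of eigenvalues of $\rho_U^{-1}$, both in descending order and counted with multiplicities, are equal. -/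

import Mathlib

universe u

open scoped ENNReal Topology ComplexOrder

/-- `T` is the minimal (spatial) tensor product of the unital C*-algebras `A` and `B`.  The embeddings
`a ↦ a ⊗ 1` and `b ↦ 1 ⊗ b` have commuting ranges, the elements `a ⊗ b = inl a * inr b` span a dense
subspace, and the norm of `∑ aᵢ ⊗ bᵢ` is the supremum of the operator norms of
`∑ π(aᵢ) ⊗ σ(bᵢ)` on `H ⊗ K` over all representations `π` of `A` on a Hilbert space `H` and `σ` of `B`
on a Hilbert space `K`.  (To compute an operator norm it suffices to take vectors `ξ` of norm at most
`1` in the algebraic tensor product, which is dense in the Hilbert space tensor product.)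
This determines `T` up to a unique isomorphism compatible with `inl` and `inr`. -/
structure SpatialTensor (A B T : Type u) [CStarAlgebra A] [CStarAlgebra B] [CStarAlgebra T] where
  inl : A →⋆ₐ[ℂ] T
  inr : B →⋆ₐ[ℂ] T
  commute : ∀ a b, Commute (inl a) (inr b)
  dense : Dense (Submodule.span ℂ {x : T | ∃ a b, x = inl a * inr b} : Set T)
  norm_isLUB : ∀ (m : ℕ) (a : Fin m → A) (b : Fin m → B),
    IsLUB {r : ℝ | ∃ (H K : Type u) (_ : NormedAddCommGroup H) (_ : NormedAddCommGroup K)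
        (_ : InnerProductSpace ℂ H) (_ : InnerProductSpace ℂ K)
        (_ : CompleteSpace H) (_ : CompleteSpace K)
        (π : A →⋆ₐ[ℂ] (H →L[ℂ] H)) (σ : B →⋆ₐ[ℂ] (K →L[ℂ] K))
        (ξ : TensorProduct ℂ H K),
        ‖ξ‖ ≤ 1 ∧ r = ‖∑ i, TensorProduct.mapL (π (a i)) (σ (b i)) ξ‖}
      ‖∑ i, inl (a i) * inr (b i)‖

/-- A compact quantum group `𝔾` (in the sense of Woronowicz) with `C(𝔾) = A`: a unital `*`-homomorphism
`Δ : A → A ⊗ A` into the minimal tensor product which is coassociative and such that the linear spans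
of `(A ⊗ 1) Δ(A)` and `(1 ⊗ A) Δ(A)` are dense in `A ⊗ A`.

`A₂` is `A ⊗ A`, and `A₃` is `A ⊗ A ⊗ A`, viewed both as `(A ⊗ A) ⊗ A` (`tensor₃`) and as `A ⊗ (A ⊗ A)`
(`tensor₃'`), with matching embeddings of the three factors. -/
structure CompactQuantumGroup (A : Type u) [CStarAlgebra A] where
  A₂ : Type u
  A₃ : Type u
  [cstar₂ : CStarAlgebra A₂]
  [cstar₃ : CStarAlgebra A₃]
  tensor₂ : SpatialTensor A A A₂
  tensor₃ : SpatialTensor A₂ A A₃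
  tensor₃' : SpatialTensor A A₂ A₃
  assoc_first : ∀ a, tensor₃.inl (tensor₂.inl a) = tensor₃'.inl a
  assoc_second : ∀ a, tensor₃.inl (tensor₂.inr a) = tensor₃'.inr (tensor₂.inl a)
  assoc_third : ∀ a, tensor₃.inr a = tensor₃'.inr (tensor₂.inr a)
  /-- The comultiplication. -/
  Δ : A →⋆ₐ[ℂ] A₂
  /-- `(Δ ⊗ id) Δ = (id ⊗ Δ) Δ`; the `*`-homomorphisms `Δ ⊗ id` and `id ⊗ Δ` are determined by their
  values on `a ⊗ 1` and on `1 ⊗ a`. -/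
  coassoc : ∃ Δid idΔ : A₂ →⋆ₐ[ℂ] A₃,
    (∀ a, Δid (tensor₂.inl a) = tensor₃.inl (Δ a)) ∧
    (∀ a, Δid (tensor₂.inr a) = tensor₃.inr a) ∧
    (∀ a, idΔ (tensor₂.inl a) = tensor₃'.inl a) ∧
    (∀ a, idΔ (tensor₂.inr a) = tensor₃'.inr (Δ a)) ∧
    ∀ a, Δid (Δ a) = idΔ (Δ a)
  dense_left : Dense (Submodule.span ℂ {x : A₂ | ∃ a b, x = tensor₂.inl a * Δ b} : Set A₂)
  dense_right : Dense (Submodule.span ℂ {x : A₂ | ∃ a b, x = tensor₂.inr a * Δ b} : Set A₂)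

attribute [instance] CompactQuantumGroup.cstar₂ CompactQuantumGroup.cstar₃

namespace CompactQuantumGroup

section Matrices

variable {A : Type u} [CStarAlgebra A]
variable {ι κ μ : Type*} [Fintype ι] [DecidableEq ι] [Fintype κ] [DecidableEq κ]
  [Fintype μ] [DecidableEq μ]

/-- `T ∈ Mor(U, V)`, i.e. `(T ⊗ 1) U = V (T ⊗ 1)`. -/
def IsMor (U : Matrix ι ι A) (V : Matrix κ κ A) (T : Matrix κ ι ℂ) : Prop :=
  T.map (algebraMap ℂ A) * U = V * T.map (algebraMap ℂ A)

/-- The contragredient `Uᶜ = (j ⊗ id)(U⁻¹)` on the dual space, where `j` sends an operator to its dual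
operator; in the dual basis, `(Uᶜ)ᵢⱼ = (U⁻¹)ⱼᵢ`. -/
noncomputable def contragredient (U : Matrix ι ι A) : Matrix ι ι A :=
  (Ring.inverse U).transpose

/-- `ρ` is the operator `ρ_U`: the (unique) positive invertible element of `Mor(U, Uᶜᶜ)` such that
`Tr(T ρ) = Tr(T ρ⁻¹)` for all `T ∈ End(U)`. -/
def IsRho (U : Matrix ι ι A) (ρ : Matrix ι ι ℂ) : Prop :=
  ρ.PosDef ∧ IsMor U (contragredient (contragredient U)) ρ ∧
    ∀ T : Matrix ι ι ℂ, IsMor U U T → (T * ρ).trace = (T * ρ⁻¹).trace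

/-- Equivalence of representations: there is an invertible `T ∈ Mor(U, V)`. -/
def IsEquivalent (U : Matrix ι ι A) (V : Matrix κ κ A) : Prop :=
  ∃ (T : Matrix κ ι ℂ) (S : Matrix ι κ ℂ), IsMor U V T ∧ S * T = 1 ∧ T * S = 1

/-- `U` is (equivalent to) a subrepresentation of `V`: there is an injective `T ∈ Mor(U, V)`. -/
def IsSubrep (U : Matrix ι ι A) (V : Matrix κ κ A) : Prop :=
  ∃ T : Matrix κ ι ℂ, IsMor U V T ∧ Function.Injective T.mulVec

/-- No invariant subspaces other than `0` and the whole (nonzero) space: if `e` is an orthogonal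
projection with `(e ⊗ 1) U (e ⊗ 1) = U (e ⊗ 1)`, then `e = 0` or `e = 1`. -/
def IsIrreducible (U : Matrix ι ι A) : Prop :=
  Nonempty ι ∧ ∀ e : Matrix ι ι ℂ, e.IsHermitian → e * e = e →
    e.map (algebraMap ℂ A) * U * e.map (algebraMap ℂ A) = U * e.map (algebraMap ℂ A) →
    e = 0 ∨ e = 1

/-- The tensor power `U^{⊗k} = U_{1,k+1} U_{2,k+1} ⋯ U_{k,k+1}` on `(ℂ^ι)^{⊗k}`: its matrix coefficients
are the ordered products `U_{f₁g₁} U_{f₂g₂} ⋯ U_{f_k g_k}`.  For `k = 0` it is the trivial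
one-dimensional representation. -/
def tensorPow (U : Matrix ι ι A) (k : ℕ) : Matrix (Fin k → ι) (Fin k → ι) A :=
  Matrix.of fun f g => (List.ofFn fun i => U (f i) (g i)).prod

/-- The direct sum `⨁_{k=0}^n U^{⊗k}`. -/
def sumTensorPow (U : Matrix ι ι A) (n : ℕ) :
    Matrix (Σ k : Fin (n + 1), (Fin (k : ℕ) → ι)) (Σ k : Fin (n + 1), (Fin (k : ℕ) → ι)) A :=
  Matrix.blockDiagonal' fun k : Fin (n + 1) => tensorPow U (k : ℕ)

theorem IsEquivalent.refl (U : Matrix ι ι A) : IsEquivalent U U :=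
  ⟨1, 1, by simp [IsMor, Matrix.map_one], by simp, by simp⟩

theorem IsEquivalent.symm {U : Matrix ι ι A} {V : Matrix κ κ A} (h : IsEquivalent U V) :
    IsEquivalent V U := by
  obtain ⟨T, S, hT, h1, h2⟩ := h
  refine ⟨S, T, ?_, h2, h1⟩
  unfold IsMor at *
  have e1 : S.map (algebraMap ℂ A) * T.map (algebraMap ℂ A) = 1 := by
    rw [← Matrix.map_mul, h1]; simp [Matrix.map_one]
  have e2 : T.map (algebraMap ℂ A) * S.map (algebraMap ℂ A) = 1 := by
    rw [← Matrix.map_mul, h2]; simp [Matrix.map_one]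
  calc S.map (algebraMap ℂ A) * V
      = S.map (algebraMap ℂ A) * (V * T.map (algebraMap ℂ A)) * S.map (algebraMap ℂ A) := by
        rw [Matrix.mul_assoc, Matrix.mul_assoc, e2, Matrix.mul_one]
    _ = U * S.map (algebraMap ℂ A) := by
        rw [← hT, ← Matrix.mul_assoc, e1, Matrix.one_mul]

theorem IsEquivalent.trans {U : Matrix ι ι A} {V : Matrix κ κ A} {W : Matrix μ μ A}
    (h : IsEquivalent U V) (h' : IsEquivalent V W) : IsEquivalent U W := by
  obtain ⟨T, S, hT, h1, h2⟩ := h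
  obtain ⟨T', S', hT', h1', h2'⟩ := h'
  refine ⟨T' * T, S * S', ?_, ?_, ?_⟩
  · unfold IsMor at *
    rw [Matrix.map_mul, Matrix.mul_assoc, hT, ← Matrix.mul_assoc, hT', Matrix.mul_assoc]
  · rw [Matrix.mul_assoc, ← Matrix.mul_assoc S', h1', Matrix.one_mul, h1]
  · rw [Matrix.mul_assoc, ← Matrix.mul_assoc T, h2, Matrix.one_mul, h2']

end Matrices

variable {A : Type u} [CStarAlgebra A] (G : CompactQuantumGroup A)

/-- A finite-dimensional unitary representation of `𝔾` on the Hilbert space with orthonormal basis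
indexed by `ι`: a unitary `U ∈ B(ℂ^ι) ⊗ A` with `(id ⊗ Δ)(U) = U₁₂ U₁₃`,
i.e. `Δ(Uᵢⱼ) = ∑ₖ Uᵢₖ ⊗ Uₖⱼ`. -/
def IsUnitaryRep {ι : Type*} [Fintype ι] [DecidableEq ι] (U : Matrix ι ι A) : Prop :=
  U ∈ unitary (Matrix ι ι A) ∧
    ∀ i j, G.Δ (U i j) = ∑ k, G.tensor₂.inl (U i k) * G.tensor₂.inr (U k j)

/-- Irreducible finite-dimensional unitary representations of `𝔾`. -/
structure IrrRep where
  dim : ℕ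
  mat : Matrix (Fin dim) (Fin dim) A
  isUnitaryRep : G.IsUnitaryRep mat
  isIrreducible : IsIrreducible mat

/-- Equivalence of irreducible representations. -/
instance irrSetoid : Setoid G.IrrRep where
  r α β := IsEquivalent α.mat β.mat
  iseqv := ⟨fun α => IsEquivalent.refl α.mat, fun h => h.symm, fun h h' => h.trans h'⟩

/-- `Irr(𝔾)`, the set of equivalence classes of irreducible unitary representations. -/
def Irr : Type u := Quotient G.irrSetoid

/-- The chosen representative `U^α` of a class `α ∈ Irr(𝔾)`. -/
noncomputable def Irr.rep {G : CompactQuantumGroup A} (α : G.Irr) : G.IrrRep := Quotient.out α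

/-- `b(U, n) = ∑ (dim α)²`, where `α` ranges over all classes of irreducible subrepresentations of
`⨁_{k=0}^n U^{⊗k}`.  (The sum has finitely many terms; taking it in `[0, ∞]` involves no convention
about infinite sums.) -/
noncomputable def growth {ι : Type*} [Fintype ι] [DecidableEq ι] (U : Matrix ι ι A) (n : ℕ) :
    ℝ≥0∞ :=
  ∑' α : {α : G.Irr // IsSubrep α.rep.mat (sumTensorPow U n)}, (α.1.rep.dim : ℝ≥0∞) ^ 2

/-- The dual of `𝔾` has subexponential growth: `b(U, n)^{1/n} → 1` for every finite-dimensional unitary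
representation `U` of `𝔾`. -/
def DualHasSubexponentialGrowth : Prop :=
  ∀ (d : ℕ) (U : Matrix (Fin d) (Fin d) A), G.IsUnitaryRep U →
    Filter.Tendsto (fun n : ℕ => G.growth U n ^ (1 / (n : ℝ))) Filter.atTop (𝓝 1)

end CompactQuantumGroup

/-- The hermitian invertible matrix `ρ` has symmetric eigenvalues: the list of eigenvalues of `ρ` and
the list of eigenvalues of `ρ⁻¹`, both with multiplicities and in descending order, agree. -/
def HasSymmetricEigenvalues {ι : Type*} [Fintype ι] [DecidableEq ι] (ρ : Matrix ι ι ℂ)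
    (hρ : ρ.IsHermitian) : Prop :=
  hρ.eigenvalues₀ = hρ.inv.eigenvalues₀

/-! The argument is a tensor power trick on the traces of powers of `ρ = ρ_U`. Suppose first that an
irreducible `W` has dimension at most `C`. Since `Tr ρ_W = Tr ρ_W⁻¹`, positivity and the power mean
inequality give `Tr ρ_W^(t+1) ≤ (Tr ρ_W)^(t+1) = (Tr ρ_W⁻¹)^(t+1) ≤ C^t Tr ρ_W^-(t+1)`, and the same
with `ρ_W` and `ρ_W⁻¹` exchanged. Both inequalities add over direct sums, so they hold for every `W`
whose irreducible subrepresentations have dimension at most `C` (`trace_pow_le`).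

For `W = U^{⊗n}` one has `ρ_W = ρ^{⊗n}`, so the traces are `n`-th powers, while subexponential
growth allows `C = (1 + ε)^n` for large `n` (`eventually_dim_le`). Taking `n`-th roots and then `ε →
0` gives `Tr ρ^(t+1) = Tr ρ^-(t+1)` for every `t`. Power sums determine a finite family of reals
with multiplicities, hence the spectrum.

The structural input is algebraic and does not go through the Haar state. `IsModular` replaces the
double contragredient by two identities: `Tr(ρ ·)` is invariant under `X ↦ U (X ⊗ 1) U*` and `Tr(ρ⁻¹
·)` under `X ↦ U* (X ⊗ 1) U`. From these and the trace condition it follows that `ρ` commutes with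
`End(U)`, that invariant subspaces are reducing, and that `IsModular` passes to subrepresentations
and to tensor products. -/

namespace Matrix

/-! ### Linear algebra: positive matrices, power sums and spectra. -/

variable {ι : Type*} [Fintype ι] [DecidableEq ι]

theorem PosDef.exists_isUnit_conjTranspose_mul_self {ρ : Matrix ι ι ℂ} (hρ : ρ.PosDef) :
    ∃ C : Matrix ι ι ℂ, IsUnit C ∧ ρ = Cᴴ * C := by
  open scoped MatrixOrder in
  have h0 : 0 ≤ ρ := nonneg_iff_posSemidef.2 hρ.posSemidef
  have hs : (CFC.sqrt ρ)ᴴ = CFC.sqrt ρ :=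
    (nonneg_iff_posSemidef.1 (CFC.sqrt_nonneg ρ)).isHermitian
  have hm : CFC.sqrt ρ * CFC.sqrt ρ = ρ := CFC.sqrt_mul_sqrt_self ρ h0
  refine ⟨CFC.sqrt ρ, ?_, by rw [hs, hm]⟩
  have hu := hρ.isUnit
  rw [Matrix.isUnit_iff_isUnit_det] at hu ⊢
  rw [← hm, det_mul] at hu
  exact isUnit_of_mul_isUnit_left hu

/-- Writing `ρ = C* C` turns the trace into the squared Hilbert–Schmidt norm of `C Z`, with `C`
invertible. -/
theorem PosDef.eq_zero_of_trace_conjTranspose_mul_mul {κ : Type*} [Fintype κ] [DecidableEq κ]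
    {ρ : Matrix ι ι ℂ} (hρ : ρ.PosDef) {Z : Matrix ι κ ℂ} (h : (Zᴴ * ρ * Z).trace = 0) : Z = 0 := by
  obtain ⟨C, hC, rfl⟩ := hρ.exists_isUnit_conjTranspose_mul_self
  have e : Zᴴ * (Cᴴ * C) * Z = (C * Z)ᴴ * (C * Z) := by
    rw [conjTranspose_mul]; simp only [Matrix.mul_assoc]
  rw [e, trace_conjTranspose_mul_self_eq_zero_iff] at h
  have hd := (Matrix.isUnit_iff_isUnit_det _).1 hC
  rw [← Matrix.one_mul Z, ← nonsing_inv_mul C hd, Matrix.mul_assoc, h, Matrix.mul_zero]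

/-- The commutator `X` of `ρ` and `T` anticommutes with `ρ`, so `Tr(X* ρ X) = -Tr(X ρ X*)`. Both
traces are nonnegative, hence zero. -/
theorem PosDef.commute_of_commute_sq {ρ T : Matrix ι ι ℂ} (hρ : ρ.PosDef)
    (h : ρ * ρ * T = T * (ρ * ρ)) : ρ * T = T * ρ := by
  set X := ρ * T - T * ρ with hX
  have e : ρ * X = -(X * ρ) := by
    rw [hX]; simp only [mul_sub, sub_mul, ← mul_assoc] at h ⊢
    rw [h]; simp only [mul_assoc]; abel
  have h1 : (Xᴴ * ρ * X).trace = -(X * ρ * Xᴴ).trace := by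
    rw [mul_assoc, e, mul_neg, trace_neg, trace_mul_comm]
  have p1 := (hρ.posSemidef.conjTranspose_mul_mul_same X).trace_nonneg
  have p2 := (hρ.posSemidef.mul_mul_conjTranspose_same X).trace_nonneg
  have h2 : (Xᴴ * ρ * X).trace = 0 := by
    refine le_antisymm ?_ p1
    rw [h1]; exact neg_nonpos.2 p2
  exact sub_eq_zero.1 (hρ.eq_zero_of_trace_conjTranspose_mul_mul h2)

/-- The columns of `V` are the eigenvectors of `e` for the eigenvalue `1`. The index type `Fin m`
suits `IrrRep` and an induction on dimension. -/
theorem IsHermitian.exists_isometry_of_idempotent {e : Matrix ι ι ℂ} (he : e.IsHermitian)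
    (h2 : e * e = e) :
    ∃ (m : ℕ) (V : Matrix ι (Fin m) ℂ), Vᴴ * V = 1 ∧ V * Vᴴ = e := by
  set W : Matrix ι ι ℂ := he.eigenvectorUnitary.1 with hW
  set lam : ι → ℂ := fun i => (he.eigenvalues i : ℂ) with hlam
  have hs : e = W * diagonal lam * Wᴴ := by
    conv_lhs => rw [he.spectral_theorem, Unitary.conjStarAlgAut_apply]
    rfl
  have hWW : Wᴴ * W = 1 := Unitary.coe_star_mul_self he.eigenvectorUnitary
  have hl : ∀ i, lam i * lam i = lam i := by
    have hd : Wᴴ * e * W = diagonal lam := by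
      rw [hs]; simp only [Matrix.mul_assoc]; rw [hWW, Matrix.mul_one, ← Matrix.mul_assoc, hWW,
        Matrix.one_mul]
    have hWW' : W * Wᴴ = 1 := mul_eq_one_comm.1 hWW
    have : diagonal lam * diagonal lam = diagonal lam := by
      rw [← hd]
      calc Wᴴ * e * W * (Wᴴ * e * W) = Wᴴ * (e * ((W * Wᴴ) * e)) * W := by
            simp only [Matrix.mul_assoc]
        _ = _ := by rw [hWW', Matrix.one_mul, h2]
    rw [diagonal_mul_diagonal] at this
    exact fun i => congrFun (diagonal_injective this) i
  let κ := {i // lam i = 1}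
  let f : Fin (Fintype.card κ) ≃ κ := (Fintype.equivFin κ).symm
  refine ⟨Fintype.card κ, W.submatrix id (fun i => (f i : ι)), ?_, ?_⟩
  · ext i j
    have := congrFun (congrFun hWW (f i : ι)) (f j : ι)
    simp only [mul_apply, conjTranspose_apply, submatrix_apply, id_eq] at this ⊢
    rw [this]
    simp only [one_apply, Subtype.coe_inj, f.injective.eq_iff]
  · rw [hs]
    ext i j
    rw [mul_apply, mul_apply]
    simp only [mul_diagonal, conjTranspose_apply, submatrix_apply, id_eq]
    rw [f.sum_comp (fun k : κ => W i k * star (W j k)),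
      ← Finset.sum_subtype (Finset.univ.filter fun k => lam k = 1) (by simp)
        (fun k => W i k * star (W j k)), Finset.sum_filter]
    refine Finset.sum_congr rfl fun k _ => ?_
    rcases eq_or_ne (lam k) 1 with h | h
    · rw [if_pos h, h, mul_one]
    · have : lam k = 0 := by
        by_contra h0
        exact h (mul_left_cancel₀ h0 (by rw [hl, mul_one]))
      rw [if_neg h, this]; simp

theorem IsHermitian.trace_pow_eq_sum_eigenvalues {ρ : Matrix ι ι ℂ} (hρ : ρ.IsHermitian) (t : ℕ) :
    (ρ ^ t).trace = ((∑ i, hρ.eigenvalues i ^ t : ℝ) : ℂ) := by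
  conv_lhs => rw [hρ.spectral_theorem, ← map_pow, Unitary.conjStarAlgAut_apply, trace_mul_cycle,
    Unitary.coe_star_mul_self, Matrix.one_mul, diagonal_pow]
  simp [trace]

theorem PosDef.trace_inv_pow_eq_sum_eigenvalues {ρ : Matrix ι ι ℂ} (hρ : ρ.PosDef) (t : ℕ) :
    (ρ⁻¹ ^ t).trace = ((∑ i, (hρ.isHermitian.eigenvalues i)⁻¹ ^ t : ℝ) : ℂ) := by
  have h := hρ.isHermitian
  have e : ρ⁻¹ = Unitary.conjStarAlgAut ℂ _ h.eigenvectorUnitary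
      (diagonal fun i => ((h.eigenvalues i)⁻¹ : ℂ)) := by
    apply inv_eq_left_inv
    refine (congrArg (_ * ·) h.spectral_theorem).trans ?_
    rw [← map_mul, diagonal_mul_diagonal]
    have : (fun i => ((h.eigenvalues i)⁻¹ : ℂ) * (RCLike.ofReal ∘ h.eigenvalues) i) = 1 := by
      ext i
      have := (hρ.eigenvalues_pos i).ne'
      simp [this]
    rw [this]; simp
  conv_lhs => rw [e, ← map_pow, Unitary.conjStarAlgAut_apply, trace_mul_cycle,
    Unitary.coe_star_mul_self, Matrix.one_mul, diagonal_pow]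
  simp [trace]

end Matrix

/-- Two finite families with equal power sums agree as multisets. -/
theorem Multiset.map_univ_eq_of_sum_pow_eq {ι κ : Type*} [Fintype ι] [Fintype κ] (f : ι → ℝ)
    (g : κ → ℝ) (h : ∀ t : ℕ, ∑ i, f i ^ t = ∑ j, g j ^ t) :
    Finset.univ.val.map f = Finset.univ.val.map g := by
  classical
  have hp : ∀ p : Polynomial ℝ, ∑ i, p.eval (f i) = ∑ j, p.eval (g j) := by
    intro p
    simp only [Polynomial.eval_eq_sum_range]
    rw [Finset.sum_comm, Finset.sum_comm (s := (Finset.univ : Finset κ))]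
    refine Finset.sum_congr rfl fun n _ => ?_
    rw [← Finset.mul_sum, ← Finset.mul_sum, h]
  ext a
  let s : Finset ℝ := insert a (Finset.univ.image f ∪ Finset.univ.image g)
  -- On all values of `f` and `g` this polynomial is the indicator of `a`, so its sum over a family
  -- is the multiplicity of `a`.
  let p : Polynomial ℝ := Lagrange.interpolate s id (fun x => if a = x then 1 else 0)
  have he : ∀ x ∈ s, p.eval x = if a = x then 1 else 0 := fun x hx =>
    Lagrange.eval_interpolate_at_node (v := id) _ (Set.injOn_id _) hx
  have := hp p
  rw [Finset.sum_congr rfl fun i _ => he (f i) (by simp [s]),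
    Finset.sum_congr rfl fun i _ => he (g i) (by simp [s])] at this
  simp only [Finset.sum_boole, Nat.cast_inj] at this
  rw [Multiset.count_map, Multiset.count_map]
  exact this

theorem Matrix.IsHermitian.eigenvalues₀_eq_of_trace_pow_eq {ι : Type*} [Fintype ι] [DecidableEq ι]
    {A B : Matrix ι ι ℂ} (hA : A.IsHermitian) (hB : B.IsHermitian)
    (h : ∀ t : ℕ, (A ^ t).trace = (B ^ t).trace) : hA.eigenvalues₀ = hB.eigenvalues₀ := by
  have key : A.charpoly.roots = B.charpoly.roots := by
    rw [hA.roots_charpoly_eq_eigenvalues, hB.roots_charpoly_eq_eigenvalues, ← Multiset.map_map,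
      ← Multiset.map_map, Multiset.map_univ_eq_of_sum_pow_eq hA.eigenvalues hB.eigenvalues]
    intro t
    have := h t
    rw [hA.trace_pow_eq_sum_eigenvalues, hB.trace_pow_eq_sum_eigenvalues] at this
    exact_mod_cast this
  rw [← List.ofFn_inj, ← hA.sort_roots_charpoly_eq_eigenvalues₀,
    ← hB.sort_roots_charpoly_eq_eigenvalues₀, key]

theorem sum_pow_le_pow_sum_of_nonneg {ι : Type*} (s : Finset ι) (f : ι → ℝ)
    (hf : ∀ i ∈ s, 0 ≤ f i) (t : ℕ) : ∑ i ∈ s, f i ^ (t + 1) ≤ (∑ i ∈ s, f i) ^ (t + 1) := by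
  rw [pow_succ', Finset.sum_mul]
  refine Finset.sum_le_sum fun i hi => ?_
  rw [pow_succ']
  exact mul_le_mul_of_nonneg_left
    (pow_le_pow_left₀ (hf i hi) (Finset.single_le_sum hf hi) t) (hf i hi)

/-- The equal first power sums link the two families; the power mean inequality costs `card ι ^ t`.
This is the only place where the dimension of an irreducible enters the estimate. -/
theorem sum_pow_le_card_pow_mul_sum_pow {ι : Type*} [Fintype ι] (f g : ι → ℝ)
    (hf : ∀ i, 0 ≤ f i) (hg : ∀ i, 0 ≤ g i) (h : ∑ i, f i = ∑ i, g i) (t : ℕ) :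
    ∑ i, f i ^ (t + 1) ≤ (Fintype.card ι : ℝ) ^ t * ∑ i, g i ^ (t + 1) := by
  refine (sum_pow_le_pow_sum_of_nonneg _ _ (fun i _ => hf i) t).trans ?_
  rw [h]
  exact pow_sum_le_card_mul_sum_pow (s := Finset.univ) (fun i _ => hg i) t


namespace CompactQuantumGroup

/-! ### Modular matrices, intertwiners and reducing subspaces. -/

section Modular

variable {A : Type u} [CStarAlgebra A]
variable {ι κ μ : Type*} [Fintype ι] [DecidableEq ι] [Fintype κ] [DecidableEq κ]
  [Fintype μ] [DecidableEq μ]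

set_option linter.unusedSectionVars false

open Matrix

theorem star_algebraMap (z : ℂ) : star (algebraMap ℂ A z) = algebraMap ℂ A (star z) :=
  (algebraMap_star_comm z).symm

theorem sum_sum_comm_sum_sum {α β γ δ M : Type*} [Fintype α] [Fintype β] [Fintype γ] [Fintype δ]
    [AddCommMonoid M] (f : α → β → γ → δ → M) :
    ∑ a, ∑ b, ∑ c, ∑ d, f a b c d = ∑ c, ∑ d, ∑ a, ∑ b, f a b c d := by
  have := Finset.sum_comm (s := Finset.univ) (t := Finset.univ)
    (f := fun (p : α × β) (q : γ × δ) => f p.1 p.2 q.1 q.2)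
  simpa only [Fintype.sum_prod_type] using this

theorem map_algebraMap_mul (S : Matrix ι κ ℂ) (T : Matrix κ μ ℂ) :
    (S * T).map (algebraMap ℂ A) = S.map (algebraMap ℂ A) * T.map (algebraMap ℂ A) :=
  Matrix.map_mul

theorem map_algebraMap_one : (1 : Matrix ι ι ℂ).map (algebraMap ℂ A) = 1 := by
  simp [Matrix.map_one]

theorem map_algebraMap_map {B : Type*} [CStarAlgebra B] (f : A →⋆ₐ[ℂ] B) (S : Matrix ι κ ℂ) :
    (S.map (algebraMap ℂ A)).map f = S.map (algebraMap ℂ B) := by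
  ext i j
  exact AlgHomClass.commutes f _

theorem conjTranspose_map_algebraMap (S : Matrix ι κ ℂ) :
    (S.map (algebraMap ℂ A))ᴴ = Sᴴ.map (algebraMap ℂ A) := by
  ext i j
  simp only [conjTranspose_apply, map_apply, star_algebraMap]

theorem trace_map_algebraMap_mul_comm (S : Matrix ι κ ℂ) (X : Matrix κ ι A) :
    (S.map (algebraMap ℂ A) * X).trace = (X * S.map (algebraMap ℂ A)).trace := by
  simp only [trace, diag_apply, mul_apply, map_apply]
  rw [Finset.sum_comm]
  exact Finset.sum_congr rfl fun _ _ => Finset.sum_congr rfl fun _ _ => Algebra.commutes _ _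

/-- The trace is a sum of positive elements `x x*` of `A`, each of which must vanish; the spectral
order supplies the positivity. -/
theorem eq_zero_of_trace_mul_conjTranspose {X : Matrix ι κ A} (h : (X * Xᴴ).trace = 0) :
    X = 0 := by
  let _ := CStarAlgebra.spectralOrder A
  have _ := CStarAlgebra.spectralOrderedRing A
  simp only [trace, diag_apply, mul_apply, conjTranspose_apply] at h
  ext i j
  have h1 := (Finset.sum_eq_zero_iff_of_nonneg fun i _ =>
    Finset.sum_nonneg fun j _ => mul_star_self_nonneg (X i j)).1 h i (Finset.mem_univ i)
  have h2 := (Finset.sum_eq_zero_iff_of_nonneg fun j _ => mul_star_self_nonneg (X i j)).1 h1 j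
    (Finset.mem_univ j)
  exact CStarRing.mul_star_self_eq_zero_iff _ |>.1 h2

/-- Over a noncommutative `A` neither the transpose nor the entrywise adjoint respects products in
general; a scalar factor makes it work here and in the next three lemmas. -/
theorem transpose_map_algebraMap_mul (S : Matrix ι κ ℂ) (X : Matrix κ μ A) :
    (S.map (algebraMap ℂ A) * X)ᵀ = Xᵀ * Sᵀ.map (algebraMap ℂ A) := by
  ext i j
  simp only [transpose_apply, mul_apply, map_apply]
  exact Finset.sum_congr rfl fun k _ => Algebra.commutes _ _

theorem transpose_mul_map_algebraMap (X : Matrix ι κ A) (S : Matrix κ μ ℂ) :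
    (X * S.map (algebraMap ℂ A))ᵀ = Sᵀ.map (algebraMap ℂ A) * Xᵀ := by
  ext i j
  simp only [transpose_apply, mul_apply, map_apply]
  exact Finset.sum_congr rfl fun k _ => (Algebra.commutes _ _).symm

theorem map_star_map_algebraMap_mul (S : Matrix ι κ ℂ) (X : Matrix κ μ A) :
    (S.map (algebraMap ℂ A) * X).map star = (S.map star).map (algebraMap ℂ A) * X.map star := by
  ext i j
  simp only [mul_apply, map_apply, star_sum, star_mul, star_algebraMap]
  exact Finset.sum_congr rfl fun k _ => (Algebra.commutes _ _).symm

theorem map_star_mul_map_algebraMap (X : Matrix ι κ A) (S : Matrix κ μ ℂ) :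
    (X * S.map (algebraMap ℂ A)).map star = X.map star * (S.map star).map (algebraMap ℂ A) := by
  ext i j
  simp only [mul_apply, map_apply, star_sum, star_mul, star_algebraMap]
  exact Finset.sum_congr rfl fun k _ => Algebra.commutes _ _

theorem IsMor.conjTranspose {U : Matrix ι ι A} (hU : U ∈ unitary (Matrix ι ι A))
    {T : Matrix ι ι ℂ} (h : IsMor U U T) : IsMor U U Tᴴ := by
  obtain ⟨h1, h2⟩ := hU
  rw [star_eq_conjTranspose] at h1 h2
  have h3 := congrArg Matrix.conjTranspose h
  rw [conjTranspose_mul, conjTranspose_mul, conjTranspose_map_algebraMap] at h3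
  unfold IsMor
  calc Tᴴ.map (algebraMap ℂ A) * U = U * (Uᴴ * Tᴴ.map (algebraMap ℂ A)) * U := by
        rw [← Matrix.mul_assoc, h2, Matrix.one_mul]
    _ = U * Tᴴ.map (algebraMap ℂ A) := by
        rw [h3, Matrix.mul_assoc, Matrix.mul_assoc, h1, Matrix.mul_one]

theorem IsMor.comp {U : Matrix ι ι A} {V : Matrix κ κ A} {W : Matrix μ μ A} {S : Matrix μ κ ℂ}
    {T : Matrix κ ι ℂ} (hS : IsMor V W S) (hT : IsMor U V T) : IsMor U W (S * T) := by
  unfold IsMor at *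
  rw [map_algebraMap_mul, Matrix.mul_assoc, hT, ← Matrix.mul_assoc, hS, Matrix.mul_assoc]

theorem IsMor.sub {U : Matrix ι ι A} {V : Matrix κ κ A} {S T : Matrix κ ι ℂ}
    (hS : IsMor U V S) (hT : IsMor U V T) : IsMor U V (S - T) := by
  unfold IsMor at *
  rw [Matrix.map_sub _ (map_sub _), Matrix.sub_mul, Matrix.mul_sub, hS, hT]

theorem IsMor.one (U : Matrix ι ι A) : IsMor U U 1 := by
  unfold IsMor
  rw [map_algebraMap_one, Matrix.one_mul, Matrix.mul_one]

theorem IsSubrep.refl (U : Matrix ι ι A) : IsSubrep U U :=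
  ⟨1, IsMor.one U, fun x y h => by simpa using h⟩

theorem IsSubrep.trans {U : Matrix ι ι A} {V : Matrix κ κ A} {W : Matrix μ μ A}
    (h : IsSubrep U V) (h' : IsSubrep V W) : IsSubrep U W := by
  obtain ⟨T, hT, hi⟩ := h
  obtain ⟨S, hS, hi'⟩ := h'
  refine ⟨S * T, hS.comp hT, fun x y h => ?_⟩
  rw [← mulVec_mulVec, ← mulVec_mulVec] at h
  exact hi (hi' h)

/-- For an isometry `V`, with `a = V*` and `b = V`, compression is multiplicative as soon as one of
the factors commutes with the projection `b * a`. -/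
theorem mul_mul_mul_of_commute' {R : Type*} [Ring R] {a : Matrix κ ι R} {b : Matrix ι κ R}
    {X Y : Matrix ι ι R} (hab : a * b = 1) (hX : b * a * X = X * (b * a)) :
    a * X * b * (a * Y * b) = a * (X * Y) * b := by
  calc a * X * b * (a * Y * b) = a * (X * (b * a)) * Y * b := by simp only [Matrix.mul_assoc]
    _ = a * b * a * X * Y * b := by rw [← hX]; simp only [Matrix.mul_assoc]
    _ = _ := by rw [hab, Matrix.one_mul]; simp only [Matrix.mul_assoc]

theorem mul_mul_mul_of_commute {R : Type*} [Ring R] {a : Matrix κ ι R} {b : Matrix ι κ R}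
    {X Y : Matrix ι ι R} (hab : a * b = 1) (hY : b * a * Y = Y * (b * a)) :
    a * X * b * (a * Y * b) = a * (X * Y) * b := by
  calc a * X * b * (a * Y * b) = a * X * (b * a * Y) * b := by simp only [Matrix.mul_assoc]
    _ = a * X * Y * b * (a * b) := by rw [hY]; simp only [Matrix.mul_assoc]
    _ = _ := by rw [hab, Matrix.mul_one]; simp only [Matrix.mul_assoc]

/-- A positive matrix `ρ` has the properties of `ρ_U` for the unitary matrix `U`.  The fields `left`
and `right` say that the matrix of adjoints of `U` is invertible with inverse `(ρ U ρ⁻¹)ᵀ`. -/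
structure IsModular (U : Matrix ι ι A) (ρ : Matrix ι ι ℂ) : Prop where
  unitary : U ∈ unitary (Matrix ι ι A)
  posDef : ρ.PosDef
  left : Uᵀ * ρᵀ.map (algebraMap ℂ A) * U.map star = ρᵀ.map (algebraMap ℂ A)
  right : U.map star * ρ⁻¹ᵀ.map (algebraMap ℂ A) * Uᵀ = ρ⁻¹ᵀ.map (algebraMap ℂ A)
  trace : ∀ T : Matrix ι ι ℂ, IsMor U U T → (T * ρ).trace = (T * ρ⁻¹).trace

/-- Paired with a scalar matrix `X`, the entries say `(Tr(ρ ·) ⊗ id)(U (X ⊗ 1) U*) = Tr(ρ X) 1`. The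
companion `right_iff` is the same for `U* (X ⊗ 1) U`, and is applied with `ρ⁻¹`. -/
theorem left_iff {U : Matrix ι ι A} {ρ : Matrix ι ι ℂ} :
    Uᵀ * ρᵀ.map (algebraMap ℂ A) * U.map star = ρᵀ.map (algebraMap ℂ A) ↔
      ∀ i j, ∑ a, ∑ c, ρ c a • (U a i * star (U c j)) = algebraMap ℂ A (ρ j i) := by
  rw [← Matrix.ext_iff]
  refine forall₂_congr fun i j => ?_
  simp only [mul_apply, transpose_apply, map_apply, Finset.sum_mul]
  rw [Finset.sum_comm]
  simp only [← Algebra.commutes (_ : ℂ) (U _ i), Algebra.smul_def, mul_assoc]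

theorem right_iff {U : Matrix ι ι A} {ρ : Matrix ι ι ℂ} :
    U.map star * ρᵀ.map (algebraMap ℂ A) * Uᵀ = ρᵀ.map (algebraMap ℂ A) ↔
      ∀ i j, ∑ a, ∑ c, ρ c a • (star (U i a) * U j c) = algebraMap ℂ A (ρ j i) := by
  rw [← Matrix.ext_iff]
  refine forall₂_congr fun i j => ?_
  simp only [mul_apply, transpose_apply, map_apply, Finset.sum_mul]
  rw [Finset.sum_comm]
  simp only [← Algebra.commutes (_ : ℂ) (star (U i _)), Algebra.smul_def, mul_assoc]

namespace IsModular

variable {U : Matrix ι ι A} {ρ : Matrix ι ι ℂ}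

theorem inv_mul_self (h : IsModular U ρ) : ρ⁻¹ * ρ = 1 :=
  nonsing_inv_mul ρ ((Matrix.isUnit_iff_isUnit_det _).1 h.posDef.isUnit)

theorem self_mul_inv (h : IsModular U ρ) : ρ * ρ⁻¹ = 1 :=
  mul_nonsing_inv ρ ((Matrix.isUnit_iff_isUnit_det _).1 h.posDef.isUnit)

/-- `Sᵀ` commutes with the entrywise adjoint `B` of `U`, and `left` and `right` make `Uᵀ` the
conjugate of `B⁻¹` by `ρᵀ`. So `ρᵀ Sᵀ (ρ⁻¹)ᵀ` commutes with `Uᵀ`. -/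
theorem isMor_inv_conj (h : IsModular U ρ) {S : Matrix ι ι ℂ} (hS : IsMor U U S) :
    IsMor U U (ρ⁻¹ * S * ρ) := by
  set P := ρᵀ.map (algebraMap ℂ A) with hP
  set Q := ρ⁻¹ᵀ.map (algebraMap ℂ A) with hQ
  set s := Sᵀ.map (algebraMap ℂ A) with hs
  set B := U.map star with hB
  have hPQ : P * Q = 1 := by
    rw [← map_algebraMap_mul, ← transpose_mul, h.inv_mul_self, transpose_one, map_algebraMap_one]
  have hQP : Q * P = 1 := by
    rw [← map_algebraMap_mul, ← transpose_mul, h.self_mul_inv, transpose_one, map_algebraMap_one]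
  have hl : Uᵀ * P * B = P := h.left
  have hr : B * Q * Uᵀ = Q := h.right
  have hc : s * B = B * s := by
    have := congrArg (fun X => Matrix.map X star) (hS.conjTranspose h.unitary)
    rw [map_star_map_algebraMap_mul, map_star_mul_map_algebraMap] at this
    have e : Sᴴ.map star = Sᵀ := by ext i j; simp
    rwa [e] at this
  have key : Uᵀ * (P * s * Q) = P * s * Q * Uᵀ := by
    calc Uᵀ * (P * s * Q) = Uᵀ * P * (s * (B * Q * Uᵀ)) := by
          rw [hr]; simp only [Matrix.mul_assoc]
      _ = Uᵀ * P * (s * B) * Q * Uᵀ := by simp only [Matrix.mul_assoc]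
      _ = Uᵀ * P * B * s * Q * Uᵀ := by rw [hc]; simp only [Matrix.mul_assoc]
      _ = _ := by rw [hl]
  have e : P * s * Q = (ρ⁻¹ * S * ρ)ᵀ.map (algebraMap ℂ A) := by
    rw [transpose_mul, transpose_mul, map_algebraMap_mul, map_algebraMap_mul, Matrix.mul_assoc]
  rw [e] at key
  have := congrArg Matrix.transpose key
  rw [transpose_mul_map_algebraMap, transpose_map_algebraMap_mul] at this
  exact this

theorem isMor_conj (h : IsModular U ρ) {S : Matrix ι ι ℂ} (hS : IsMor U U S) :
    IsMor U U (ρ * S * ρ⁻¹) := by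
  have := (h.isMor_inv_conj (hS.conjTranspose h.unitary)).conjTranspose h.unitary
  rwa [conjTranspose_mul, conjTranspose_mul, conjTranspose_conjTranspose,
    h.posDef.inv.isHermitian.eq, h.posDef.isHermitian.eq, ← Matrix.mul_assoc] at this

/-- The trace condition makes `Y = ρ T ρ⁻¹ - ρ⁻¹ T ρ`, an element of `End(U)`, orthogonal to
`End(U)` for the faithful functional `Tr(· ρ)`. Testing against `Y*` gives `Y = 0`, so `ρ²` commutes
with `T`, and then so does `ρ`. -/
theorem commute_of_isMor (h : IsModular U ρ) {T : Matrix ι ι ℂ} (hT : IsMor U U T) :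
    ρ * T = T * ρ := by
  set Y := ρ * T * ρ⁻¹ - ρ⁻¹ * T * ρ with hY
  have m1 := h.isMor_conj hT
  have m2 := h.isMor_inv_conj hT
  have mY : IsMor U U Y := m1.sub m2
  have hS : ∀ S, IsMor U U S → (S * Y * ρ).trace = 0 := by
    intro S mS
    have e1 : S * (ρ * T * ρ⁻¹) * ρ = S * ρ * T := by
      simp only [Matrix.mul_assoc]; rw [h.inv_mul_self, Matrix.mul_one]
    have e2 : S * (ρ⁻¹ * T * ρ) * ρ⁻¹ = S * ρ⁻¹ * T := by
      simp only [Matrix.mul_assoc]; rw [h.self_mul_inv, Matrix.mul_one]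
    rw [hY, Matrix.mul_sub, Matrix.sub_mul, trace_sub, h.trace _ (mS.comp m2), e1, e2,
      trace_mul_comm, trace_mul_comm (S * ρ⁻¹), ← Matrix.mul_assoc, ← Matrix.mul_assoc,
      h.trace _ (hT.comp mS), sub_self]
  have h0 := hS Yᴴ (mY.conjTranspose h.unitary)
  have hZ : (Yᴴᴴ * ρ * Yᴴ).trace = 0 := by
    rw [conjTranspose_conjTranspose, trace_mul_comm, ← Matrix.mul_assoc]; exact h0
  have hY0 : Y = 0 := by
    have := h.posDef.eq_zero_of_trace_conjTranspose_mul_mul hZ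
    rw [← conjTranspose_conjTranspose Y, this, conjTranspose_zero]
  have he : ρ * T * ρ⁻¹ = ρ⁻¹ * T * ρ := sub_eq_zero.1 hY0
  refine h.posDef.commute_of_commute_sq ?_
  calc ρ * ρ * T = ρ * (ρ * T * ρ⁻¹) * ρ := by
        simp only [Matrix.mul_assoc]; rw [h.inv_mul_self, Matrix.mul_one]
    _ = ρ * ρ⁻¹ * T * (ρ * ρ) := by rw [he]; simp only [Matrix.mul_assoc]
    _ = _ := by rw [h.self_mul_inv, Matrix.one_mul]

/-- Invariant subspaces are reducing. -/
theorem isMor_of_invariant (h : IsModular U ρ) {e : Matrix ι ι ℂ} (he : e.IsHermitian)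
    (h2 : e * e = e)
    (hi : e.map (algebraMap ℂ A) * U * e.map (algebraMap ℂ A) = U * e.map (algebraMap ℂ A)) :
    IsMor U U e := by
  obtain ⟨hU1, hU2⟩ := h.unitary
  rw [star_eq_conjTranspose] at hU1 hU2
  set E := e.map (algebraMap ℂ A) with hE
  have hEE : E * E = E := by rw [hE, ← map_algebraMap_mul, h2]
  have hEs : Eᴴ = E := by rw [hE, conjTranspose_map_algebraMap, he.eq]
  -- Invariance gives `B B* = E - U E U*`, whose trace against `ρ` vanishes because `Tr(ρ ·)` is
  -- invariant under `U (·) U*`. Faithfulness then kills the commutator `B`.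
  set B := E * U - U * E with hB
  have hi' : E * Uᴴ * E = E * Uᴴ := by
    have := congrArg Matrix.conjTranspose hi
    simpa only [conjTranspose_mul, hEs, Matrix.mul_assoc] using this
  have hBB : B * Bᴴ = E - U * E * Uᴴ := by
    have t1 : E * U * Uᴴ * E = E := by rw [Matrix.mul_assoc E, hU2, Matrix.mul_one, hEE]
    have t2 : E * U * E * Uᴴ = U * E * Uᴴ := by rw [hi]
    have t3 : U * E * Uᴴ * E = U * E * Uᴴ := by
      rw [Matrix.mul_assoc U, Matrix.mul_assoc U, hi']
    have t4 : U * E * E * Uᴴ = U * E * Uᴴ := by rw [Matrix.mul_assoc U, hEE]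
    rw [hB, conjTranspose_sub, conjTranspose_mul, conjTranspose_mul, hEs, Matrix.sub_mul,
      Matrix.mul_sub, Matrix.mul_sub, ← Matrix.mul_assoc, ← Matrix.mul_assoc, ← Matrix.mul_assoc,
      ← Matrix.mul_assoc, t1, t2, t3, t4, sub_self, sub_zero]
  have hl := left_iff.1 h.left
  have htr : (ρ.map (algebraMap ℂ A) * (U * E * Uᴴ)).trace
      = (ρ.map (algebraMap ℂ A) * E).trace := by
    have : ∀ i j, ∑ a, ∑ c, (e i j * ρ c a) • (U a i * star (U c j))
        = algebraMap ℂ A (e i j * ρ j i) := by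
      intro i j
      simp only [mul_smul, ← Finset.smul_sum]
      rw [hl, Algebra.smul_def, map_mul]
    simp only [Matrix.trace, diag_apply, mul_apply, map_apply, hE, conjTranspose_apply,
      Finset.sum_mul, Finset.mul_sum]
    have l1 : ∀ c a j i, algebraMap ℂ A (ρ c a) * (U a i * algebraMap ℂ A (e i j) * star (U c j))
        = (e i j * ρ c a) • (U a i * star (U c j)) := by
      intro c a j i
      rw [← Algebra.commutes, mul_comm, Algebra.smul_def, map_mul]
      simp only [mul_assoc]
    simp only [l1]
    calc ∑ c, ∑ a, ∑ j, ∑ i, (e i j * ρ c a) • (U a i * star (U c j))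
        = ∑ j, ∑ i, ∑ a, ∑ c, (e i j * ρ c a) • (U a i * star (U c j)) := by
          rw [sum_sum_comm_sum_sum]
          exact Finset.sum_congr rfl fun j _ => Finset.sum_congr rfl fun i _ => Finset.sum_comm
      _ = _ := by
          simp only [this]
          refine Finset.sum_congr rfl fun j _ => Finset.sum_congr rfl fun i _ => ?_
          rw [mul_comm, map_mul]
  have h0 : (ρ.map (algebraMap ℂ A) * (B * Bᴴ)).trace = 0 := by
    rw [hBB, Matrix.mul_sub, trace_sub, htr, sub_self]
  obtain ⟨C, hC, hρ⟩ := h.posDef.exists_isUnit_conjTranspose_mul_self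
  set c := C.map (algebraMap ℂ A) with hc
  -- The `A`-valued trace is not cyclic, but the scalar factor `c` can be moved around it.
  have h1 : ((c * B) * (c * B)ᴴ).trace = 0 := by
    have e1 : (c * (B * (Bᴴ * cᴴ))).trace = (B * (Bᴴ * cᴴ) * c).trace :=
      trace_map_algebraMap_mul_comm C _
    have e2 := trace_map_algebraMap_mul_comm ρ (B * Bᴴ)
    have e3 : ρ.map (algebraMap ℂ A) = cᴴ * c := by
      rw [hρ, map_algebraMap_mul, hc, conjTranspose_map_algebraMap]
    rw [h0, e3] at e2
    rw [conjTranspose_mul, Matrix.mul_assoc, e1, e2]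
    simp only [Matrix.mul_assoc]
  have h3 : c * B = 0 := eq_zero_of_trace_mul_conjTranspose h1
  have hd := (Matrix.isUnit_iff_isUnit_det _).1 hC
  have h4 : B = 0 := by
    rw [← Matrix.one_mul B, ← map_algebraMap_one, ← nonsing_inv_mul C hd, map_algebraMap_mul,
      Matrix.mul_assoc, h3, Matrix.mul_zero]
  exact sub_eq_zero.1 h4

theorem compress_inv_mul (h : IsModular U ρ) {V : Matrix ι κ ℂ} (hV : Vᴴ * V = 1)
    (hm : IsMor U U (V * Vᴴ)) : (Vᴴ * ρ * V)⁻¹ = Vᴴ * ρ⁻¹ * V := by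
  apply inv_eq_left_inv
  calc Vᴴ * ρ⁻¹ * V * (Vᴴ * ρ * V) = Vᴴ * ρ⁻¹ * (V * Vᴴ * ρ) * V := by
        simp only [Matrix.mul_assoc]
    _ = Vᴴ * (ρ⁻¹ * ρ) * V * (Vᴴ * V) := by
        rw [← h.commute_of_isMor hm]; simp only [Matrix.mul_assoc]
    _ = 1 := by rw [h.inv_mul_self, hV, Matrix.mul_one, Matrix.mul_one, hV]

/-- The restriction of a representation to a reducing subspace. -/
theorem compress (h : IsModular U ρ) {V : Matrix ι κ ℂ} (hV : Vᴴ * V = 1)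
    (hm : IsMor U U (V * Vᴴ)) :
    IsModular (Vᴴ.map (algebraMap ℂ A) * U * V.map (algebraMap ℂ A)) (Vᴴ * ρ * V) := by
  obtain ⟨hU1, hU2⟩ := h.unitary
  rw [star_eq_conjTranspose] at hU1 hU2
  have hVi : Function.Injective V.mulVec := fun x y hxy => by
    have := congrArg Vᴴ.mulVec hxy
    simpa [mulVec_mulVec, hV] using this
  have hcU : V.map (algebraMap ℂ A) * Vᴴ.map (algebraMap ℂ A) * U
      = U * (V.map (algebraMap ℂ A) * Vᴴ.map (algebraMap ℂ A)) := by
    rw [← map_algebraMap_mul]; exact hm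
  have hcUs : V.map (algebraMap ℂ A) * Vᴴ.map (algebraMap ℂ A) * Uᴴ
      = Uᴴ * (V.map (algebraMap ℂ A) * Vᴴ.map (algebraMap ℂ A)) := by
    have := congrArg Matrix.conjTranspose hcU
    simp only [conjTranspose_mul, conjTranspose_map_algebraMap, conjTranspose_conjTranspose] at this
    exact this.symm
  have hab : Vᴴ.map (algebraMap ℂ A) * V.map (algebraMap ℂ A) = 1 := by
    rw [← map_algebraMap_mul, hV, map_algebraMap_one]
  have hst : (Vᴴ.map (algebraMap ℂ A) * U * V.map (algebraMap ℂ A))ᴴ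
      = Vᴴ.map (algebraMap ℂ A) * Uᴴ * V.map (algebraMap ℂ A) := by
    simp only [conjTranspose_mul, conjTranspose_map_algebraMap, conjTranspose_conjTranspose,
      Matrix.mul_assoc]
  have hab' : Vᵀ.map (algebraMap ℂ A) * Vᴴᵀ.map (algebraMap ℂ A) = 1 := by
    rw [← map_algebraMap_mul, ← transpose_mul, hV, transpose_one, map_algebraMap_one]
  have hE : (V * Vᴴ)ᵀ.map (algebraMap ℂ A)
      = Vᴴᵀ.map (algebraMap ℂ A) * Vᵀ.map (algebraMap ℂ A) := by
    rw [transpose_mul, map_algebraMap_mul]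
  have hcT : Vᴴᵀ.map (algebraMap ℂ A) * Vᵀ.map (algebraMap ℂ A) * Uᵀ
      = Uᵀ * (Vᴴᵀ.map (algebraMap ℂ A) * Vᵀ.map (algebraMap ℂ A)) := by
    have := congrArg Matrix.transpose hm
    rw [transpose_map_algebraMap_mul, transpose_mul_map_algebraMap] at this
    rw [← hE, this]
  have hcB : Vᴴᵀ.map (algebraMap ℂ A) * Vᵀ.map (algebraMap ℂ A) * U.map star
      = U.map star * (Vᴴᵀ.map (algebraMap ℂ A) * Vᵀ.map (algebraMap ℂ A)) := by
    have := congrArg (fun X => Matrix.map X star) hm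
    rw [map_star_map_algebraMap_mul, map_star_mul_map_algebraMap] at this
    have e : (V * Vᴴ).map star = (V * Vᴴ)ᵀ := by
      ext i j
      exact (isHermitian_mul_conjTranspose_self V).apply j i
    rwa [e, hE] at this
  have hs1 : Vᴴ.map star = Vᵀ := by ext i j; simp
  have hs2 : V.map star = Vᴴᵀ := by ext i j; simp
  have hT : (Vᴴ.map (algebraMap ℂ A) * U * V.map (algebraMap ℂ A))ᵀ
      = Vᵀ.map (algebraMap ℂ A) * Uᵀ * Vᴴᵀ.map (algebraMap ℂ A) := by
    rw [transpose_mul_map_algebraMap, transpose_map_algebraMap_mul, Matrix.mul_assoc]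
  have hS : (Vᴴ.map (algebraMap ℂ A) * U * V.map (algebraMap ℂ A)).map star
      = Vᵀ.map (algebraMap ℂ A) * U.map star * Vᴴᵀ.map (algebraMap ℂ A) := by
    rw [map_star_mul_map_algebraMap, map_star_map_algebraMap_mul, hs1, hs2]
  have hR : ∀ σ : Matrix ι ι ℂ, (Vᴴ * σ * V)ᵀ.map (algebraMap ℂ A)
      = Vᵀ.map (algebraMap ℂ A) * σᵀ.map (algebraMap ℂ A) * Vᴴᵀ.map (algebraMap ℂ A) := by
    intro σ
    rw [transpose_mul, transpose_mul, map_algebraMap_mul, map_algebraMap_mul, Matrix.mul_assoc]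
  refine ⟨⟨?_, ?_⟩, h.posDef.conjTranspose_mul_mul_same hVi, ?_, ?_, fun T hT => ?_⟩
  · rw [star_eq_conjTranspose, hst, mul_mul_mul_of_commute hab hcU, hU1, Matrix.mul_one, hab]
  · rw [star_eq_conjTranspose, hst, mul_mul_mul_of_commute hab hcUs, hU2, Matrix.mul_one, hab]
  · rw [hT, hS, hR, mul_mul_mul_of_commute' hab' hcT, mul_mul_mul_of_commute hab' hcB, h.left]
  · rw [h.compress_inv_mul hV hm, hT, hS, hR, mul_mul_mul_of_commute' hab' hcB,
      mul_mul_mul_of_commute hab' hcT, h.right]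
  · rw [h.compress_inv_mul hV hm]
    -- An intertwiner of the compression extends by zero to one of `U`, which reduces the trace
    -- condition to that of `U`.
    have hM : IsMor U U (V * T * Vᴴ) := by
      have h1 := hT
      unfold IsMor at h1 ⊢
      rw [map_algebraMap_mul, map_algebraMap_mul]
      set v := V.map (algebraMap ℂ A)
      set w := Vᴴ.map (algebraMap ℂ A)
      set τ := T.map (algebraMap ℂ A)
      have hw : w * U = w * U * v * w := by
        calc w * U = w * (v * w * U) := by
              rw [← Matrix.mul_assoc, ← Matrix.mul_assoc, hab, Matrix.one_mul]
          _ = _ := by rw [hcU]; simp only [Matrix.mul_assoc]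
      have hv : U * v = v * w * U * v := by
        rw [hcU]; simp only [Matrix.mul_assoc]; rw [hab, Matrix.mul_one]
      calc v * τ * w * U = v * τ * (w * U * v * w) := by rw [← hw, Matrix.mul_assoc]
        _ = v * (τ * (w * U * v)) * w := by simp only [Matrix.mul_assoc]
        _ = v * w * U * v * τ * w := by rw [h1]; simp only [Matrix.mul_assoc]
        _ = _ := by rw [← hv]; simp only [Matrix.mul_assoc]
    have ht : ∀ σ : Matrix ι ι ℂ, (T * (Vᴴ * σ * V)).trace = (V * T * Vᴴ * σ).trace := by
      intro σ
      rw [← Matrix.mul_assoc, trace_mul_comm]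
      simp only [Matrix.mul_assoc]
    rw [ht, ht, h.trace _ hM]

theorem compress_pow (h : IsModular U ρ) {V : Matrix ι κ ℂ} (hV : Vᴴ * V = 1)
    (hm : IsMor U U (V * Vᴴ)) (t : ℕ) : (Vᴴ * ρ * V) ^ t = Vᴴ * ρ ^ t * V := by
  induction t with
  | zero => rw [pow_zero, pow_zero, Matrix.mul_one, hV]
  | succ t ih =>
    rw [pow_succ, ih, pow_succ]
    calc Vᴴ * ρ ^ t * V * (Vᴴ * ρ * V) = Vᴴ * ρ ^ t * (V * Vᴴ * ρ) * V := by
          simp only [Matrix.mul_assoc]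
      _ = Vᴴ * (ρ ^ t * ρ) * V * (Vᴴ * V) := by
          rw [← h.commute_of_isMor hm]; simp only [Matrix.mul_assoc]
      _ = _ := by rw [hV, Matrix.mul_one]

theorem compress_inv_pow (h : IsModular U ρ) {V : Matrix ι κ ℂ} (hV : Vᴴ * V = 1)
    (hm : IsMor U U (V * Vᴴ)) (t : ℕ) : ((Vᴴ * ρ * V)⁻¹) ^ t = Vᴴ * ρ⁻¹ ^ t * V := by
  rw [h.compress_inv_mul hV hm]
  have hc : ρ⁻¹ * (V * Vᴴ) = V * Vᴴ * ρ⁻¹ := by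
    calc ρ⁻¹ * (V * Vᴴ) = ρ⁻¹ * (V * Vᴴ * ρ) * ρ⁻¹ := by
          rw [Matrix.mul_assoc, Matrix.mul_assoc _ ρ, h.self_mul_inv, Matrix.mul_one]
      _ = ρ⁻¹ * ρ * (V * Vᴴ) * ρ⁻¹ := by
          rw [← h.commute_of_isMor hm]; simp only [Matrix.mul_assoc]
      _ = _ := by rw [h.inv_mul_self, Matrix.one_mul]
  induction t with
  | zero => rw [pow_zero, pow_zero, Matrix.mul_one, hV]
  | succ t ih =>
    rw [pow_succ, ih, pow_succ]
    calc Vᴴ * ρ⁻¹ ^ t * V * (Vᴴ * ρ⁻¹ * V) = Vᴴ * ρ⁻¹ ^ t * (V * Vᴴ * ρ⁻¹) * V := by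
          simp only [Matrix.mul_assoc]
      _ = Vᴴ * (ρ⁻¹ ^ t * ρ⁻¹) * V * (Vᴴ * V) := by
          rw [← hc]; simp only [Matrix.mul_assoc]
      _ = _ := by rw [hV, Matrix.mul_one]

end IsModular

theorem isSubrep_compress {U : Matrix ι ι A} {V : Matrix ι κ ℂ} (hV : Vᴴ * V = 1)
    (hm : IsMor U U (V * Vᴴ)) :
    IsSubrep (Vᴴ.map (algebraMap ℂ A) * U * V.map (algebraMap ℂ A)) U := by
  refine ⟨V, ?_, fun x y hxy => ?_⟩
  · unfold IsMor at *
    rw [← Matrix.mul_assoc, ← Matrix.mul_assoc, ← map_algebraMap_mul, hm, Matrix.mul_assoc,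
      ← map_algebraMap_mul, Matrix.mul_assoc, hV, Matrix.mul_one]
  · have := congrArg Vᴴ.mulVec hxy
    simpa [mulVec_mulVec, hV] using this

theorem isUnitaryRep_compress {G : CompactQuantumGroup A} {U : Matrix ι ι A}
    (hU : G.IsUnitaryRep U) {V : Matrix ι κ ℂ}
    (hV : Vᴴ * V = 1) (hm : IsMor U U (V * Vᴴ))
    (hu : Vᴴ.map (algebraMap ℂ A) * U * V.map (algebraMap ℂ A) ∈ unitary (Matrix κ κ A)) :
    G.IsUnitaryRep (Vᴴ.map (algebraMap ℂ A) * U * V.map (algebraMap ℂ A)) := by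
  refine ⟨hu, ?_⟩
  -- Read over `A₂`, the identity `(id ⊗ Δ)(U) = U₁₂ U₁₃` is a matrix product, so multiplicativity
  -- of compression applies.
  have hD : U.map G.Δ = U.map G.tensor₂.inl * U.map G.tensor₂.inr := by
    ext i j
    rw [map_apply, hU.2]
    rfl
  have key : ∀ f : A →⋆ₐ[ℂ] G.A₂,
      (Vᴴ.map (algebraMap ℂ A) * U * V.map (algebraMap ℂ A)).map f
        = Vᴴ.map (algebraMap ℂ G.A₂) * U.map f * V.map (algebraMap ℂ G.A₂) := by
    intro f
    rw [Matrix.map_mul, Matrix.map_mul, map_algebraMap_map, map_algebraMap_map]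
  have hc : V.map (algebraMap ℂ G.A₂) * Vᴴ.map (algebraMap ℂ G.A₂) * U.map G.tensor₂.inl
      = U.map G.tensor₂.inl * (V.map (algebraMap ℂ G.A₂) * Vᴴ.map (algebraMap ℂ G.A₂)) := by
    have := congrArg (fun X => Matrix.map X G.tensor₂.inl) hm
    simp only [Matrix.map_mul] at this
    rwa [map_algebraMap_map, map_algebraMap_map] at this
  have hab : Vᴴ.map (algebraMap ℂ G.A₂) * V.map (algebraMap ℂ G.A₂) = 1 := by
    rw [← map_algebraMap_mul, hV, map_algebraMap_one]
  have := key G.Δ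
  rw [hD, ← mul_mul_mul_of_commute' hab hc, ← key, ← key] at this
  intro i j
  exact congrFun (congrFun this i) j

end Modular

end CompactQuantumGroup

namespace CompactQuantumGroup

/-! ### Tensor products of two representations. -/

section Kronecker

variable {A : Type u} [CStarAlgebra A]
variable {ι κ : Type*} [Fintype ι] [DecidableEq ι] [Fintype κ] [DecidableEq κ]

set_option linter.unusedSectionVars false

open Matrix
open scoped Kronecker

/-- The partial trace `(id ⊗ Tr)(T (1 ⊗ σ))`. -/
def partialTraceRight (T : Matrix (ι × κ) (ι × κ) ℂ) (σ : Matrix κ κ ℂ) : Matrix ι ι ℂ :=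
  Matrix.of fun i j => ∑ k, ∑ l, T (i, k) (j, l) * σ l k

/-- The partial trace `(Tr ⊗ id)(T (τ ⊗ 1))`. -/
def partialTraceLeft (T : Matrix (ι × κ) (ι × κ) ℂ) (τ : Matrix ι ι ℂ) : Matrix κ κ ℂ :=
  Matrix.of fun k l => ∑ i, ∑ j, T (i, k) (j, l) * τ j i

theorem trace_partialTraceRight (T : Matrix (ι × κ) (ι × κ) ℂ) (τ : Matrix ι ι ℂ)
    (σ : Matrix κ κ ℂ) : (partialTraceRight T σ * τ).trace = (T * (τ ⊗ₖ σ)).trace := by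
  simp only [trace, diag_apply, mul_apply, partialTraceRight, of_apply, Fintype.sum_prod_type,
    kroneckerMap_apply, Finset.sum_mul]
  refine Finset.sum_congr rfl fun i _ => ?_
  rw [Finset.sum_comm]
  refine Finset.sum_congr rfl fun k _ => Finset.sum_congr rfl fun j _ =>
    Finset.sum_congr rfl fun l _ => by ring

theorem trace_partialTraceLeft (T : Matrix (ι × κ) (ι × κ) ℂ) (τ : Matrix ι ι ℂ)
    (σ : Matrix κ κ ℂ) : (partialTraceLeft T τ * σ).trace = (T * (τ ⊗ₖ σ)).trace := by
  simp only [trace, diag_apply, mul_apply, partialTraceLeft, of_apply, Fintype.sum_prod_type,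
    kroneckerMap_apply, Finset.sum_mul]
  rw [Finset.sum_congr rfl fun k _ => Finset.sum_comm, Finset.sum_comm]
  refine Finset.sum_congr rfl fun i _ => Finset.sum_congr rfl fun k _ => ?_
  rw [Finset.sum_comm]
  refine Finset.sum_congr rfl fun j _ =>
    Finset.sum_congr rfl fun l _ => by ring

theorem isMor_iff {U : Matrix ι ι A} {T : Matrix ι ι ℂ} :
    IsMor U U T ↔ ∀ i p, ∑ j, T i j • U j p = ∑ j, T j p • U i j := by
  unfold IsMor
  rw [← Matrix.ext_iff]
  refine forall₂_congr fun i p => ?_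
  simp only [mul_apply, map_apply, Algebra.smul_def, ← Algebra.commutes (_ : ℂ) (U i _)]

theorem sum_mul_star_of_unitary {V : Matrix κ κ A} (hV : V ∈ unitary (Matrix κ κ A)) (l r : κ) :
    ∑ q, V l q * star (V r q) = if l = r then 1 else 0 := by
  have := congrFun (congrFun hV.2 l) r
  simpa only [mul_apply, star_apply, one_apply] using this

theorem sum_star_mul_of_unitary {V : Matrix κ κ A} (hV : V ∈ unitary (Matrix κ κ A)) (l r : κ) :
    ∑ q, star (V q l) * V q r = if l = r then 1 else 0 := by
  have := congrFun (congrFun hV.1 l) r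
  simpa only [mul_apply, star_apply, one_apply] using this

theorem isMor_kronecker_iff {U : Matrix ι ι A} {V : Matrix κ κ A}
    {T : Matrix (ι × κ) (ι × κ) ℂ} :
    IsMor (U ⊗ₖ V) (U ⊗ₖ V) T ↔ ∀ i k p q, ∑ j, ∑ l, T (i, k) (j, l) • (U j p * V l q)
      = ∑ j, ∑ l, T (j, l) (p, q) • (U i j * V k l) := by
  rw [isMor_iff]
  simp only [Prod.forall, Fintype.sum_prod_type, kroneckerMap_apply]

/-- Multiplying the intertwining relation on the right by `V*` isolates `U` on one side. On the
other, invariance of `Tr(σ ·)` under `V (·) V*` removes `V`. -/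
theorem isMor_partialTraceRight {U : Matrix ι ι A} {V : Matrix κ κ A}
    {T : Matrix (ι × κ) (ι × κ) ℂ} {σ : Matrix κ κ ℂ} (hV : IsModular V σ)
    (hT : IsMor (U ⊗ₖ V) (U ⊗ₖ V) T) : IsMor U U (partialTraceRight T σ) := by
  rw [isMor_kronecker_iff] at hT
  have hA : ∀ i k p r, ∑ j, T (i, k) (j, r) • U j p
      = ∑ q, ∑ j, ∑ l, T (j, l) (p, q) • (U i j * V k l * star (V r q)) := by
    intro i k p r
    have e : ∀ q, ∑ j, ∑ l, T (j, l) (p, q) • (U i j * V k l * star (V r q))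
        = ∑ j, ∑ l, T (i, k) (j, l) • (U j p * (V l q * star (V r q))) := by
      intro q
      have := congrArg (· * star (V r q)) (hT i k p q)
      simp only [Finset.sum_mul, smul_mul_assoc, mul_assoc] at this
      simp only [mul_assoc, this]
    simp only [e]
    rw [Finset.sum_comm]
    refine Finset.sum_congr rfl fun j _ => ?_
    rw [Finset.sum_comm]
    simp only [← Finset.smul_sum, ← Finset.mul_sum, sum_mul_star_of_unitary hV.unitary]
    simp
  have hl := left_iff.1 hV.left
  rw [isMor_iff]
  intro i p
  calc ∑ j, partialTraceRight T σ i j • U j p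
      = ∑ k, ∑ r, σ r k • ∑ j, T (i, k) (j, r) • U j p := by
        simp only [partialTraceRight, of_apply, Finset.sum_smul, Finset.smul_sum, smul_smul]
        rw [Finset.sum_comm]
        refine Finset.sum_congr rfl fun k _ => ?_
        rw [Finset.sum_comm]
        simp only [mul_comm]
    _ = ∑ k, ∑ r, ∑ q, ∑ m : ι × κ,
          (T m (p, q) * σ r k) • (U i m.1 * (V k m.2 * star (V r q))) := by
        simp only [hA, Finset.smul_sum, smul_smul, Fintype.sum_prod_type, mul_assoc]
        simp only [mul_comm]
    _ = ∑ q, ∑ m : ι × κ, T m (p, q) • (U i m.1 *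
          ∑ k, ∑ r, σ r k • (V k m.2 * star (V r q))) := by
        rw [sum_sum_comm_sum_sum]
        simp only [Finset.smul_sum, Finset.mul_sum, mul_smul_comm, smul_smul]
    _ = ∑ j, partialTraceRight T σ j p • U i j := by
        simp only [hl, partialTraceRight, of_apply, Finset.sum_smul, Fintype.sum_prod_type]
        rw [Finset.sum_comm]
        refine Finset.sum_congr rfl fun j _ => ?_
        rw [Finset.sum_comm]
        refine Finset.sum_congr rfl fun l _ => Finset.sum_congr rfl fun q _ => ?_
        rw [← Algebra.commutes, ← Algebra.smul_def, smul_smul]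

/-- In the products `U j p * V l q` the factor `U` is cancelled from the left, by `U*`. The
functional invariant under `U* (·) U` has density `ρ⁻¹`, which is why `ρ⁻¹` appears here and `σ` in
the right partial trace. -/
theorem isMor_partialTraceLeft {U : Matrix ι ι A} {V : Matrix κ κ A}
    {T : Matrix (ι × κ) (ι × κ) ℂ} {ρ : Matrix ι ι ℂ} (hU : IsModular U ρ)
    (hT : IsMor (U ⊗ₖ V) (U ⊗ₖ V) T) : IsMor V V (partialTraceLeft T ρ⁻¹) := by
  rw [isMor_kronecker_iff] at hT
  have hA : ∀ r k p q, ∑ l, T (r, l) (p, q) • V k l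
      = ∑ i, ∑ j, ∑ l, T (i, k) (j, l) • (star (U i r) * U j p * V l q) := by
    intro r k p q
    have e : ∀ i, ∑ j, ∑ l, T (i, k) (j, l) • (star (U i r) * U j p * V l q)
        = ∑ j, ∑ l, T (j, l) (p, q) • (star (U i r) * U i j * V k l) := by
      intro i
      have := congrArg (star (U i r) * ·) (hT i k p q)
      simpa only [Finset.mul_sum, mul_smul_comm, ← mul_assoc] using this
    simp only [e]
    rw [Finset.sum_comm, Finset.sum_congr rfl fun j _ => Finset.sum_comm]
    simp only [← Finset.smul_sum, ← Finset.sum_mul, sum_star_mul_of_unitary hU.unitary]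
    rw [Finset.sum_comm]
    simp
  have hl := right_iff.1 hU.right
  rw [isMor_iff]
  intro k q
  symm
  calc ∑ l, partialTraceLeft T ρ⁻¹ l q • V k l
      = ∑ r, ∑ p, ρ⁻¹ p r • ∑ l, T (r, l) (p, q) • V k l := by
        simp only [partialTraceLeft, of_apply, Finset.sum_smul, Finset.smul_sum, smul_smul]
        rw [Finset.sum_comm]
        refine Finset.sum_congr rfl fun k _ => ?_
        rw [Finset.sum_comm]
        simp only [mul_comm]
    _ = ∑ r, ∑ p, ∑ i, ∑ m : ι × κ,
          (T (i, k) m * ρ⁻¹ p r) • (star (U i r) * U m.1 p * V m.2 q) := by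
        simp only [hA, Finset.smul_sum, smul_smul, Fintype.sum_prod_type]
        simp only [mul_comm (ρ⁻¹ _ _)]
    _ = ∑ i, ∑ m : ι × κ, T (i, k) m • ((∑ r, ∑ p, ρ⁻¹ p r • (star (U i r) * U m.1 p)) *
          V m.2 q) := by
        rw [sum_sum_comm_sum_sum]
        simp only [Finset.smul_sum, Finset.sum_mul, smul_mul_assoc, smul_smul]
    _ = ∑ l, partialTraceLeft T ρ⁻¹ k l • V l q := by
        simp only [hl, partialTraceLeft, of_apply, Finset.sum_smul, Fintype.sum_prod_type]
        rw [Finset.sum_congr rfl fun i _ => Finset.sum_comm, Finset.sum_comm]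
        refine Finset.sum_congr rfl fun l _ => Finset.sum_congr rfl fun i _ =>
          Finset.sum_congr rfl fun j _ => ?_
        rw [← Algebra.smul_def, smul_smul]

theorem unitary_kronecker {U : Matrix ι ι A} {V : Matrix κ κ A}
    (hU : U ∈ unitary (Matrix ι ι A)) (hV : V ∈ unitary (Matrix κ κ A)) :
    U ⊗ₖ V ∈ unitary (Matrix (ι × κ) (ι × κ) A) := by
  constructor
  · ext ⟨j, l⟩ ⟨j', l'⟩
    simp only [mul_apply, star_apply, kroneckerMap_apply, Fintype.sum_prod_type, star_mul,
      one_apply, Prod.mk.injEq]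
    rw [Finset.sum_comm]
    have : ∀ k i, star (V k l) * star (U i j) * (U i j' * V k l')
        = star (V k l) * ((star (U i j) * U i j') * V k l') := fun k i => by simp only [mul_assoc]
    simp only [this, ← Finset.mul_sum, ← Finset.sum_mul, sum_star_mul_of_unitary hU]
    by_cases h : j = j'
    · simp only [h, if_true, one_mul, sum_star_mul_of_unitary hV, true_and]
    · simp [h]
  · ext ⟨j, l⟩ ⟨j', l'⟩
    simp only [mul_apply, star_apply, kroneckerMap_apply, Fintype.sum_prod_type, star_mul,
      one_apply, Prod.mk.injEq]
    have : ∀ i k, U j i * V l k * (star (V l' k) * star (U j' i))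
        = U j i * ((V l k * star (V l' k)) * star (U j' i)) := fun k i => by simp only [mul_assoc]
    simp only [this, ← Finset.mul_sum, ← Finset.sum_mul, sum_mul_star_of_unitary hV]
    by_cases h : l = l'
    · simp only [h, if_true, one_mul, sum_mul_star_of_unitary hU, and_true]
    · simp [h]

/-- `ρ_{U ⊗ V} = ρ_U ⊗ ρ_V`. -/
theorem IsModular.kronecker {U : Matrix ι ι A} {V : Matrix κ κ A} {ρ : Matrix ι ι ℂ}
    {σ : Matrix κ κ ℂ} (hU : IsModular U ρ) (hV : IsModular V σ) :
    IsModular (U ⊗ₖ V) (ρ ⊗ₖ σ) := by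
  refine ⟨unitary_kronecker hU.unitary hV.unitary, hU.posDef.kronecker hV.posDef, ?_, ?_, ?_⟩
  · rw [left_iff]
    have hl := left_iff.1 hU.left
    have hl' := left_iff.1 hV.left
    rintro ⟨i, k⟩ ⟨j, l⟩
    simp only [Fintype.sum_prod_type, kroneckerMap_apply, star_mul]
    -- The adjoint reverses products, so the `V` factors are adjacent inside; their sum collapses to
    -- a scalar and leaves the identity for `U`.
    calc ∑ a, ∑ b, ∑ c, ∑ d, (ρ c a * σ d b) • (U a i * V b k * (star (V d l) * star (U c j)))
        = ∑ a, ∑ c, ρ c a • (U a i * (∑ b, ∑ d, σ d b • (V b k * star (V d l)))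
            * star (U c j)) := by
          refine Finset.sum_congr rfl fun a _ => ?_
          rw [Finset.sum_comm]
          simp only [Finset.smul_sum, Finset.mul_sum, Finset.sum_mul, mul_smul_comm,
            smul_mul_assoc, smul_smul, mul_assoc]
      _ = _ := by
          simp only [hl', ← Algebra.commutes, mul_assoc]
          simp only [← Algebra.smul_def, smul_comm (ρ _ _) (σ _ _), ← Finset.smul_sum, hl]
          rw [Algebra.smul_def, ← map_mul, mul_comm]
  · rw [inv_kronecker, right_iff]
    have hl := right_iff.1 hU.right
    have hl' := right_iff.1 hV.right
    rintro ⟨i, k⟩ ⟨j, l⟩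
    simp only [Fintype.sum_prod_type, kroneckerMap_apply, star_mul]
    calc ∑ a, ∑ b, ∑ c, ∑ d, (ρ⁻¹ c a * σ⁻¹ d b) •
            (star (V k b) * star (U i a) * (U j c * V l d))
        = ∑ b, ∑ d, σ⁻¹ d b • (star (V k b) *
            (∑ a, ∑ c, ρ⁻¹ c a • (star (U i a) * U j c)) * V l d) := by
          rw [Finset.sum_comm]
          refine Finset.sum_congr rfl fun b _ => ?_
          rw [Finset.sum_congr rfl fun a _ => Finset.sum_comm, Finset.sum_comm]
          simp only [Finset.smul_sum, Finset.mul_sum, Finset.sum_mul, mul_smul_comm,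
            smul_mul_assoc, smul_smul, mul_assoc]
          simp only [mul_comm (σ⁻¹ _ _)]
      _ = _ := by
          simp only [hl, ← Algebra.commutes, mul_assoc]
          simp only [← Algebra.smul_def, smul_comm (σ⁻¹ _ _) (ρ⁻¹ _ _), ← Finset.smul_sum, hl']
          rw [Algebra.smul_def, ← map_mul]
  · intro T hT
    -- One leg is inverted at a time: `ρ ⊗ σ` becomes `ρ⁻¹ ⊗ σ` by slicing with `σ`, then `ρ⁻¹ ⊗
    -- σ⁻¹` by slicing with `ρ⁻¹`.
    rw [inv_kronecker, ← trace_partialTraceRight, hU.trace _ (isMor_partialTraceRight hV hT),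
      trace_partialTraceRight, ← trace_partialTraceLeft,
      hV.trace _ (isMor_partialTraceLeft hU hT), trace_partialTraceLeft]

theorem trace_submatrix_equiv (X : Matrix ι ι ℂ) (e : κ ≃ ι) :
    (X.submatrix e e).trace = X.trace :=
  e.sum_comp fun i => X i i

theorem IsModular.submatrix {U : Matrix ι ι A} {ρ : Matrix ι ι ℂ} (h : IsModular U ρ)
    (e : κ ≃ ι) : IsModular (U.submatrix e e) (ρ.submatrix e e) := by
  have h1 : star U * U = 1 := h.unitary.1
  have h2 : U * star U = 1 := h.unitary.2
  refine ⟨⟨?_, ?_⟩, h.posDef.submatrix e.injective, ?_, ?_, fun T hT => ?_⟩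
  · have : star (U.submatrix e e) = (star U).submatrix e e := rfl
    rw [this, submatrix_mul_equiv, h1, submatrix_one_equiv]
  · have : star (U.submatrix e e) = (star U).submatrix e e := rfl
    rw [this, submatrix_mul_equiv, h2, submatrix_one_equiv]
  · have := congrArg (fun X => Matrix.submatrix X e e) h.left
    simp only [← submatrix_mul_equiv _ _ _ e _] at this
    exact this
  · rw [inv_submatrix_equiv]
    have := congrArg (fun X => Matrix.submatrix X e e) h.right
    simp only [← submatrix_mul_equiv _ _ _ e _] at this
    exact this
  · have hM : IsMor U U (T.submatrix e.symm e.symm) := by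
      have := congrArg (fun X => Matrix.submatrix X e.symm e.symm) hT
      simp only [← submatrix_mul_equiv _ _ _ e.symm _, submatrix_submatrix,
        Equiv.self_comp_symm, submatrix_id_id] at this
      exact this
    have ht : ∀ σ : Matrix ι ι ℂ, (T * σ.submatrix e e).trace
        = (T.submatrix e.symm e.symm * σ).trace := by
      intro σ
      have : T * σ.submatrix e e = (T.submatrix e.symm e.symm * σ).submatrix e e := by
        rw [← submatrix_mul_equiv _ _ _ e _, submatrix_submatrix]
        simp
      rw [this, trace_submatrix_equiv]
    rw [inv_submatrix_equiv, ht, ht, h.trace _ hM]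

theorem isModular_one [Unique ι] : IsModular (1 : Matrix ι ι A) (1 : Matrix ι ι ℂ) := by
  refine ⟨one_mem _, PosDef.one, ?_, ?_, ?_⟩
  · simp [Matrix.map_one]
  · simp [Matrix.map_one]
  · simp

end Kronecker

/-! ### Tensor powers. -/

section TensorPow

variable {A : Type u} [CStarAlgebra A]
variable {ι : Type*} [Fintype ι] [DecidableEq ι]

open Matrix
open scoped Kronecker

theorem tensorPow_zero (U : Matrix ι ι A) : tensorPow U 0 = 1 := by
  ext f g
  rw [Subsingleton.elim f g]
  simp [tensorPow]

theorem tensorPow_succ (U : Matrix ι ι A) (k : ℕ) :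
    tensorPow U (k + 1) = (U ⊗ₖ tensorPow U k).submatrix (Fin.consEquiv fun _ => ι).symm
      (Fin.consEquiv fun _ => ι).symm := by
  ext f g
  simp [tensorPow, Fin.consEquiv, Fin.tail]

theorem IsModular.tensorPow {U : Matrix ι ι A} {ρ : Matrix ι ι ℂ} (h : IsModular U ρ) (k : ℕ) :
    IsModular (tensorPow U k) (tensorPow ρ k) := by
  induction k with
  | zero => rw [tensorPow_zero, tensorPow_zero]; exact isModular_one
  | succ k ih => rw [tensorPow_succ, tensorPow_succ]; exact (h.kronecker ih).submatrix _

theorem tensorPow_inv (ρ : Matrix ι ι ℂ) (k : ℕ) : (tensorPow ρ k)⁻¹ = tensorPow ρ⁻¹ k := by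
  induction k with
  | zero => rw [tensorPow_zero, tensorPow_zero, inv_one]
  | succ k ih => rw [tensorPow_succ, tensorPow_succ, inv_submatrix_equiv, inv_kronecker, ih]

theorem submatrix_equiv_pow {κ : Type*} [Fintype κ] [DecidableEq κ] (X : Matrix ι ι ℂ)
    (e : κ ≃ ι) (t : ℕ) : X.submatrix e e ^ t = (X ^ t).submatrix e e := by
  induction t with
  | zero => simp
  | succ t ih => rw [pow_succ, pow_succ, ih, submatrix_mul_equiv]

theorem kronecker_pow {κ : Type*} [Fintype κ] [DecidableEq κ] (X : Matrix ι ι ℂ)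
    (Y : Matrix κ κ ℂ) (t : ℕ) : (X ⊗ₖ Y) ^ t = (X ^ t) ⊗ₖ (Y ^ t) := by
  induction t with
  | zero => simp
  | succ t ih => rw [pow_succ, pow_succ, pow_succ, ih, mul_kronecker_mul]

/-- This multiplicativity lets a bound on `U^{⊗n}` be divided out by an `n`-th root. -/
theorem trace_tensorPow_pow (ρ : Matrix ι ι ℂ) (k t : ℕ) :
    (tensorPow ρ k ^ t).trace = (ρ ^ t).trace ^ k := by
  induction k with
  | zero => simp [tensorPow_zero]
  | succ k ih =>
    rw [tensorPow_succ, submatrix_equiv_pow, trace_submatrix_equiv, kronecker_pow,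
      trace_kronecker, ih, pow_succ']

theorem IsUnitaryRep.tensorPow {G : CompactQuantumGroup A} {U : Matrix ι ι A}
    {ρ : Matrix ι ι ℂ} (hU : G.IsUnitaryRep U) (h : IsModular U ρ) (k : ℕ) :
    G.IsUnitaryRep (tensorPow U k) := by
  refine ⟨(h.tensorPow k).unitary, ?_⟩
  induction k with
  | zero =>
    have h1 : ∀ f g : Fin 0 → ι, CompactQuantumGroup.tensorPow U 0 f g = 1 := fun f g => by
      simp [CompactQuantumGroup.tensorPow]
    intro f g
    simp [h1]
  | succ k ih =>
    intro f g
    rw [tensorPow_succ, ← (Fin.consEquiv fun _ => ι).sum_comp]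
    simp only [submatrix_apply, kroneckerMap_apply, map_mul, Equiv.symm_apply_apply, hU.2, ih,
      Fintype.sum_prod_type]
    rw [Finset.sum_mul_sum]
    refine Finset.sum_congr rfl fun a _ => Finset.sum_congr rfl fun b _ => ?_
    rw [mul_assoc, mul_assoc, ← mul_assoc (G.tensor₂.inr _),
      ← (G.tensor₂.commute _ _).eq, mul_assoc]

/-- Inclusion of the top summand, so that irreducibles in `U^{⊗n}` are counted by `growth U n`. -/
theorem isSubrep_sumTensorPow (U : Matrix ι ι A) (n : ℕ) :
    IsSubrep (tensorPow U n) (sumTensorPow U n) := by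
  let s : (Fin n → ι) → (Σ k : Fin (n + 1), (Fin (k : ℕ) → ι)) := fun g => ⟨Fin.last n, g⟩
  have hs : Function.Injective s := fun f g h => by
    simpa [s] using h
  let S : Matrix (Σ k : Fin (n + 1), (Fin (k : ℕ) → ι)) (Fin n → ι) ℂ :=
    Matrix.of fun p g => if p = s g then 1 else 0
  have S_self : ∀ g, S (s g) g = 1 := fun g => by simp [S]
  have S_ne : ∀ p g, p ≠ s g → S p g = 0 := fun p g h => by simp [S, h]
  have hsum : ∀ f g : Fin n → ι,
      ∑ h, algebraMap ℂ A (S (s f) h) * tensorPow U n h g = tensorPow U n f g := by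
    intro f g
    rw [Finset.sum_eq_single_of_mem f (Finset.mem_univ _) fun h _ hh => by
      rw [S_ne _ _ fun e => hh (hs e).symm, map_zero, zero_mul], S_self, map_one, one_mul]
  refine ⟨S, ?_, ?_⟩
  · unfold IsMor
    ext ⟨k, f⟩ g
    simp only [mul_apply, map_apply]
    rw [Finset.sum_eq_single_of_mem (s g) (Finset.mem_univ _) fun q _ hq => by
      rw [S_ne q g hq, map_zero, mul_zero], S_self, map_one, mul_one]
    by_cases hk : k = Fin.last n
    · subst hk
      exact (hsum f g).trans (blockDiagonal'_apply_eq
        (fun k : Fin (n + 1) => tensorPow U (k : ℕ)) (Fin.last n) f g).symm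
    · have h1 : sumTensorPow U n ⟨k, f⟩ (s g) = 0 := blockDiagonal'_apply_ne _ _ _ hk
      rw [h1]
      refine Finset.sum_eq_zero fun h _ => ?_
      rw [S_ne _ _ fun e => hk (congrArg Sigma.fst e), map_zero, zero_mul]
  · intro x y h
    ext f
    have := congrFun h (s f)
    simpa [mulVec, dotProduct, S, hs.eq_iff] using this

end TensorPow

end CompactQuantumGroup

namespace CompactQuantumGroup

/-! ### Growth, dimension bounds and comparison of traces. -/

section Growth

variable {A : Type u} [CStarAlgebra A]

open Matrix

/-- For unitary `U` the contragredient is the entrywise adjoint `B`, so `Uᶜᶜ` is `(B⁻¹)ᵀ`, and `ρ ∈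
Mor(U, Uᶜᶜ)` transposes to `left`. -/
theorem IsRho.isModular [Nontrivial A] {d : ℕ} {U : Matrix (Fin d) (Fin d) A}
    {ρ : Matrix (Fin d) (Fin d) ℂ} (hU : U ∈ unitary (Matrix (Fin d) (Fin d) A))
    (h : IsRho U ρ) : IsModular U ρ := by
  obtain ⟨hpos, hm, htr⟩ := h
  have h1 : Uᴴ * U = 1 := hU.1
  have h2 : U * Uᴴ = 1 := hU.2
  have hdet := (Matrix.isUnit_iff_isUnit_det _).1 hpos.isUnit
  have hc : contragredient U = U.map star := by
    have : Ring.inverse U = Uᴴ := Ring.inverse_unit (⟨U, Uᴴ, h2, h1⟩ : (Matrix _ _ A)ˣ)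
    rw [contragredient, this]
    ext i j
    simp
  set B := U.map star with hB
  rw [hc] at hm
  -- `Ring.inverse` is `0` on non-units; that value would give `ρ U = 0`, impossible for unitary `U`
  -- when `A ≠ 0` and `d > 0`.
  have hunit : IsUnit B := by
    rcases isEmpty_or_nonempty (Fin d) with hd | hd
    · exact isUnit_of_subsingleton B
    by_contra hn
    have h0 : contragredient B = 0 := by
      rw [contragredient, Ring.inverse_non_unit _ hn, transpose_zero]
    unfold IsMor at hm
    rw [h0, Matrix.zero_mul] at hm
    have : (1 : Matrix (Fin d) (Fin d) A) = 0 := by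
      calc (1 : Matrix (Fin d) (Fin d) A)
          = ρ⁻¹.map (algebraMap ℂ A) * (ρ.map (algebraMap ℂ A) * U) * Uᴴ := by
            rw [← Matrix.mul_assoc, ← map_algebraMap_mul, nonsing_inv_mul ρ hdet,
              map_algebraMap_one, Matrix.one_mul, h2]
        _ = 0 := by rw [hm, Matrix.mul_zero, Matrix.zero_mul]
    exact one_ne_zero this
  obtain ⟨u, hu⟩ := hunit
  have hY1 : B * (↑u⁻¹ : Matrix (Fin d) (Fin d) A) = 1 := by rw [← hu]; exact u.mul_inv
  have hY2 : (↑u⁻¹ : Matrix (Fin d) (Fin d) A) * B = 1 := by rw [← hu]; exact u.inv_mul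
  have hcc : contragredient B = (↑u⁻¹ : Matrix (Fin d) (Fin d) A)ᵀ := by
    rw [contragredient, ← hu, Ring.inverse_unit]
  set Y : Matrix (Fin d) (Fin d) A := ↑u⁻¹
  rw [hcc] at hm
  have hk : Uᵀ * ρᵀ.map (algebraMap ℂ A) = ρᵀ.map (algebraMap ℂ A) * Y := by
    have := congrArg Matrix.transpose hm
    rwa [transpose_map_algebraMap_mul, transpose_mul_map_algebraMap, transpose_transpose] at this
  refine ⟨hU, hpos, ?_, ?_, htr⟩
  · rw [hk, Matrix.mul_assoc, hY2, Matrix.mul_one]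
  · have hPQ : ρᵀ.map (algebraMap ℂ A) * ρ⁻¹ᵀ.map (algebraMap ℂ A) = 1 := by
      rw [← map_algebraMap_mul, ← transpose_mul, nonsing_inv_mul ρ hdet, transpose_one,
        map_algebraMap_one]
    have hQP : ρ⁻¹ᵀ.map (algebraMap ℂ A) * ρᵀ.map (algebraMap ℂ A) = 1 := by
      rw [← map_algebraMap_mul, ← transpose_mul, mul_nonsing_inv ρ hdet, transpose_one,
        map_algebraMap_one]
    calc B * ρ⁻¹ᵀ.map (algebraMap ℂ A) * Uᵀ
        = B * ρ⁻¹ᵀ.map (algebraMap ℂ A) * (Uᵀ * ρᵀ.map (algebraMap ℂ A))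
            * ρ⁻¹ᵀ.map (algebraMap ℂ A) := by
          simp only [Matrix.mul_assoc]; rw [hPQ, Matrix.mul_one]
      _ = B * (ρ⁻¹ᵀ.map (algebraMap ℂ A) * ρᵀ.map (algebraMap ℂ A)) * Y
            * ρ⁻¹ᵀ.map (algebraMap ℂ A) := by
          rw [hk]; simp only [Matrix.mul_assoc]
      _ = _ := by rw [hQP, Matrix.mul_one, hY1, Matrix.one_mul]

theorem IsEquivalent.isSubrep {ι κ : Type*} [Fintype ι] [DecidableEq ι] [Fintype κ]
    [DecidableEq κ] {U : Matrix ι ι A} {V : Matrix κ κ A} (h : IsEquivalent U V) :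
    IsSubrep U V := by
  obtain ⟨T, S, hT, h1, -⟩ := h
  refine ⟨T, hT, fun x y hxy => ?_⟩
  have := congrArg S.mulVec hxy
  simpa [mulVec_mulVec, h1] using this

theorem dim_sq_le_growth {G : CompactQuantumGroup A} {ι : Type*} [Fintype ι] [DecidableEq ι]
    (U : Matrix ι ι A) (n : ℕ) (α : G.IrrRep) (h : IsSubrep α.mat (sumTensorPow U n)) :
    (α.dim : ℝ≥0∞) ^ 2 ≤ G.growth U n := by
  let c : G.Irr := Quotient.mk G.irrSetoid α
  have he : IsEquivalent c.rep.mat α.mat := Quotient.mk_out (s := G.irrSetoid) α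
  have hd : c.rep.dim = α.dim := by
    obtain ⟨T, S, -, h1, h2⟩ := he
    simpa using square_of_invertible S T h1 h2
  have := ENNReal.le_tsum (f := fun α : {α : G.Irr // IsSubrep α.rep.mat (sumTensorPow U n)} =>
    (α.1.rep.dim : ℝ≥0∞) ^ 2) ⟨c, he.isSubrep.trans h⟩
  rw [← hd]
  exact this

theorem lt_of_isometry {d m : ℕ} {V : Matrix (Fin d) (Fin m) ℂ} (hV : Vᴴ * V = 1)
    (h1 : V * Vᴴ ≠ 1) : m < d := by
  have hle : m ≤ d := by
    have e1 := rank_mul_le_right Vᴴ V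
    rw [hV, rank_one, Fintype.card_fin] at e1
    exact e1.trans ((rank_le_card_height V).trans_eq (Fintype.card_fin d))
  refine lt_of_le_of_ne hle ?_
  rintro rfl
  exact h1 (mul_eq_one_comm.1 hV)

/-- If all irreducible subrepresentations of `W` have dimension at most `C`, then the traces of the
powers of `ρ_W` and of `ρ_W⁻¹` are comparable. -/
theorem trace_pow_le_of_fin {G : CompactQuantumGroup A} {C : ℝ} (t d : ℕ) :
    ∀ {W : Matrix (Fin d) (Fin d) A} {ρ : Matrix (Fin d) (Fin d) ℂ}, G.IsUnitaryRep W →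
      IsModular W ρ → (∀ α : G.IrrRep, IsSubrep α.mat W → (α.dim : ℝ) ≤ C) →
      (ρ ^ (t + 1)).trace.re ≤ C ^ t * (ρ⁻¹ ^ (t + 1)).trace.re ∧
      (ρ⁻¹ ^ (t + 1)).trace.re ≤ C ^ t * (ρ ^ (t + 1)).trace.re := by
  induction d using Nat.strong_induction_on with
  | _ d ih =>
  intro W ρ hW hρ hirr
  by_cases hI : IsIrreducible W
  · have hd : (d : ℝ) ≤ C := hirr ⟨d, W, hW, hI⟩ (IsSubrep.refl W)
    have hp := fun i => (hρ.posDef.eigenvalues_pos i).le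
    have hi : ∀ i, 0 ≤ (hρ.posDef.isHermitian.eigenvalues i)⁻¹ := fun i => inv_nonneg.2 (hp i)
    have hs : ∑ i, hρ.posDef.isHermitian.eigenvalues i
        = ∑ i, (hρ.posDef.isHermitian.eigenvalues i)⁻¹ := by
      have h1 := hρ.posDef.isHermitian.trace_pow_eq_sum_eigenvalues 1
      have h2 := hρ.posDef.trace_inv_pow_eq_sum_eigenvalues 1
      -- For an irreducible only the identity intertwiner is needed: `Tr ρ = Tr ρ⁻¹`.
      have h3 := hρ.trace 1 (IsMor.one W)
      simp only [pow_one, Matrix.one_mul] at h1 h2 h3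
      rw [h1, h2] at h3
      exact_mod_cast h3
    rw [hρ.posDef.isHermitian.trace_pow_eq_sum_eigenvalues,
      hρ.posDef.trace_inv_pow_eq_sum_eigenvalues, Complex.ofReal_re, Complex.ofReal_re]
    have key : ∀ f g : Fin d → ℝ, (∀ i, 0 ≤ f i) → (∀ i, 0 ≤ g i) → ∑ i, f i = ∑ i, g i →
        ∑ i, f i ^ (t + 1) ≤ C ^ t * ∑ i, g i ^ (t + 1) := by
      intro f g hf hg hfg
      refine (sum_pow_le_card_pow_mul_sum_pow f g hf hg hfg t).trans ?_
      rw [Fintype.card_fin]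
      exact mul_le_mul_of_nonneg_right (pow_le_pow_left₀ (Nat.cast_nonneg d) hd t)
        (Finset.sum_nonneg fun i _ => pow_nonneg (hg i) _)
    exact ⟨key _ _ hp hi hs, key _ _ hi hp hs.symm⟩
  · rcases Nat.eq_zero_or_pos d with rfl | hd
    · simp [Matrix.trace]
    have hne : Nonempty (Fin d) := ⟨⟨0, hd⟩⟩
    simp only [IsIrreducible, hne, true_and, not_forall, not_or] at hI
    obtain ⟨e, he, h2, hinv, h0, h1⟩ := hI
    have hm : IsMor W W e := hρ.isMor_of_invariant he h2 hinv
    have he' : (1 - e).IsHermitian := isHermitian_one.sub he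
    have h2' : (1 - e) * (1 - e) = 1 - e := by
      rw [Matrix.mul_sub, Matrix.mul_one, Matrix.sub_mul, Matrix.one_mul, h2, sub_self, sub_zero]
    have hm' : IsMor W W (1 - e) := (IsMor.one W).sub hm
    -- The induction hypothesis on the range of a proper reducing projection, used for `e` and for
    -- `1 - e`.
    have piece : ∀ e : Matrix (Fin d) (Fin d) ℂ, e.IsHermitian → e * e = e → e ≠ 1 →
        IsMor W W e →
        (e * ρ ^ (t + 1)).trace.re ≤ C ^ t * (e * ρ⁻¹ ^ (t + 1)).trace.re ∧
        (e * ρ⁻¹ ^ (t + 1)).trace.re ≤ C ^ t * (e * ρ ^ (t + 1)).trace.re := by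
      intro e he h2 h1 hm
      obtain ⟨m, V, hV, rfl⟩ := he.exists_isometry_of_idempotent h2
      have hc := hρ.compress hV hm
      have := ih m (lt_of_isometry hV h1) (isUnitaryRep_compress hW hV hm hc.unitary) hc
        fun α hα => hirr α (hα.trans (isSubrep_compress hV hm))
      rw [hρ.compress_pow hV hm, hρ.compress_inv_pow hV hm] at this
      rwa [Matrix.mul_assoc, Matrix.mul_assoc, trace_mul_comm Vᴴ, trace_mul_comm Vᴴ,
        Matrix.mul_assoc, Matrix.mul_assoc, trace_mul_comm (ρ ^ _), trace_mul_comm (ρ⁻¹ ^ _)]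
        at this
    have hsplit : ∀ X : Matrix (Fin d) (Fin d) ℂ,
        X.trace.re = (e * X).trace.re + ((1 - e) * X).trace.re := by
      intro X
      rw [← Complex.add_re, ← trace_add, ← Matrix.add_mul, add_sub_cancel, Matrix.one_mul]
    have p1 := piece e he h2 h1 hm
    have p2 := piece (1 - e) he' h2' (fun h => h0 (by simpa using h)) hm'
    rw [hsplit (ρ ^ (t + 1)), hsplit (ρ⁻¹ ^ (t + 1)), mul_add, mul_add]
    exact ⟨add_le_add p1.1 p2.1, add_le_add p1.2 p2.2⟩

theorem trace_pow_le {G : CompactQuantumGroup A} {ι : Type*} [Fintype ι] [DecidableEq ι]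
    {C : ℝ} (t : ℕ) {W : Matrix ι ι A} {ρ : Matrix ι ι ℂ} (hW : G.IsUnitaryRep W)
    (hρ : IsModular W ρ) (hirr : ∀ α : G.IrrRep, IsSubrep α.mat W → (α.dim : ℝ) ≤ C) :
    (ρ ^ (t + 1)).trace.re ≤ C ^ t * (ρ⁻¹ ^ (t + 1)).trace.re ∧
      (ρ⁻¹ ^ (t + 1)).trace.re ≤ C ^ t * (ρ ^ (t + 1)).trace.re := by
  -- An isometry onto the range of the projection `1` only reindexes the space by `Fin m`.
  obtain ⟨m, V, hV, hVV⟩ :=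
    (isHermitian_one (n := ι) (α := ℂ)).exists_isometry_of_idempotent (mul_one 1)
  have hm : IsMor W W (V * Vᴴ) := by rw [hVV]; exact IsMor.one W
  have hc := hρ.compress hV hm
  have := trace_pow_le_of_fin t m (isUnitaryRep_compress hW hV hm hc.unitary) hc
    fun α hα => hirr α (hα.trans (isSubrep_compress hV hm))
  rw [hρ.compress_pow hV hm, hρ.compress_inv_pow hV hm] at this
  rwa [trace_mul_comm _ V, trace_mul_comm _ V, ← Matrix.mul_assoc, ← Matrix.mul_assoc, hVV,
    Matrix.one_mul, Matrix.one_mul] at this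

/-- `dim α ≤ (dim α)² ≤ b(U, n) ≤ (1 + ε)^n` for large `n`. The case `n = 0` is excluded because the
exponent `1 / n` is then `0` and the root cannot be undone. -/
theorem eventually_dim_le {G : CompactQuantumGroup A} (hG : G.DualHasSubexponentialGrowth) {d : ℕ}
    {U : Matrix (Fin d) (Fin d) A} (hU : G.IsUnitaryRep U) {ε : ℝ} (hε : 0 < ε) :
    ∀ᶠ n : ℕ in Filter.atTop, ∀ α : G.IrrRep, IsSubrep α.mat (tensorPow U n) →
      (α.dim : ℝ) ≤ (1 + ε) ^ n := by
  have h1 : (1 : ℝ≥0∞) < ENNReal.ofReal (1 + ε) := by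
    rw [ENNReal.one_lt_ofReal]; linarith
  filter_upwards [(hG d U hU).eventually (Iio_mem_nhds h1), Filter.eventually_ge_atTop 1]
    with n hn hn1 α hα
  have hn0 : (n : ℝ) ≠ 0 := by positivity
  have h2 : G.growth U n ≤ ENNReal.ofReal ((1 + ε) ^ n) := by
    rw [ENNReal.ofReal_pow (by linarith)]
    calc G.growth U n = (G.growth U n ^ (1 / (n : ℝ))) ^ n := by
          rw [← ENNReal.rpow_natCast, ← ENNReal.rpow_mul, one_div, inv_mul_cancel₀ hn0,
            ENNReal.rpow_one]
      _ ≤ _ := pow_le_pow_left' (le_of_lt hn) n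
  have h3 := (dim_sq_le_growth U n α (hα.trans (isSubrep_sumTensorPow U n))).trans h2
  have h4 : ((α.dim : ℝ)) ^ 2 ≤ (1 + ε) ^ n := by
    have : ENNReal.ofReal ((α.dim : ℝ) ^ 2) ≤ ENNReal.ofReal ((1 + ε) ^ n) := by
      rwa [ENNReal.ofReal_pow (Nat.cast_nonneg _), ENNReal.ofReal_natCast]
    exact (ENNReal.ofReal_le_ofReal_iff (by positivity)).1 this
  refine le_trans ?_ h4
  exact_mod_cast Nat.le_self_pow two_ne_zero α.dim

/-- The `n`-th root leaves the factor `(1 + ε)^t` with `t` fixed, which tends to `1` as `ε → 0`. -/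
theorem le_of_exists_pow_le {x y : ℝ} (hy : 0 ≤ y) (t : ℕ)
    (h : ∀ ε : ℝ, 0 < ε → ∃ n : ℕ, n ≠ 0 ∧ x ^ n ≤ ((1 + ε) ^ n) ^ t * y ^ n) : x ≤ y := by
  have h1 : ∀ ε : ℝ, 0 < ε → x ≤ (1 + ε) ^ t * y := by
    intro ε hε
    obtain ⟨n, hn, hx⟩ := h ε hε
    rw [← pow_mul, mul_comm n, pow_mul, ← mul_pow] at hx
    exact le_of_pow_le_pow_left₀ hn (by positivity) hx
  have hc : Filter.Tendsto (fun ε : ℝ => (1 + ε) ^ t * y) (𝓝[>] 0) (𝓝 ((1 + 0) ^ t * y)) :=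
    (Continuous.tendsto (by fun_prop) 0).mono_left nhdsWithin_le_nhds
  rw [add_zero, one_pow, one_mul] at hc
  exact ge_of_tendsto hc (Filter.eventually_of_mem self_mem_nhdsWithin h1)

theorem trace_pow_eq_trace_inv_pow {G : CompactQuantumGroup A}
    (hG : G.DualHasSubexponentialGrowth) {d : ℕ} {U : Matrix (Fin d) (Fin d) A}
    (hU : G.IsUnitaryRep U) {ρ : Matrix (Fin d) (Fin d) ℂ} (hρ : IsModular U ρ) (t : ℕ) :
    (ρ ^ (t + 1)).trace = (ρ⁻¹ ^ (t + 1)).trace := by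
  have hx := hρ.posDef.isHermitian.trace_pow_eq_sum_eigenvalues (t + 1)
  have hy := hρ.posDef.trace_inv_pow_eq_sum_eigenvalues (t + 1)
  set x : ℝ := ∑ i, hρ.posDef.isHermitian.eigenvalues i ^ (t + 1)
  set y : ℝ := ∑ i, (hρ.posDef.isHermitian.eigenvalues i)⁻¹ ^ (t + 1)
  have hp := fun i => (hρ.posDef.eigenvalues_pos i).le
  have hx0 : 0 ≤ x := Finset.sum_nonneg fun i _ => pow_nonneg (hp i) _
  have hy0 : 0 ≤ y := Finset.sum_nonneg fun i _ => pow_nonneg (inv_nonneg.2 (hp i)) _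
  have key : ∀ ε : ℝ, 0 < ε → ∃ n : ℕ, n ≠ 0 ∧ x ^ n ≤ ((1 + ε) ^ n) ^ t * y ^ n ∧
      y ^ n ≤ ((1 + ε) ^ n) ^ t * x ^ n := by
    intro ε hε
    obtain ⟨n, hn, hn0⟩ :=
      ((eventually_dim_le hG hU hε).and (Filter.eventually_ne_atTop 0)).exists
    have := trace_pow_le t (hU.tensorPow hρ n) (hρ.tensorPow n) hn
    rw [tensorPow_inv, trace_tensorPow_pow, trace_tensorPow_pow, hx, hy, ← Complex.ofReal_pow,
      ← Complex.ofReal_pow, Complex.ofReal_re, Complex.ofReal_re] at this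
    exact ⟨n, hn0, this⟩
  rw [hx, hy]
  congr 1
  refine le_antisymm (le_of_exists_pow_le hy0 t fun ε hε => ?_)
    (le_of_exists_pow_le hx0 t fun ε hε => ?_)
  · obtain ⟨n, hn, h1, -⟩ := key ε hε
    exact ⟨n, hn, h1⟩
  · obtain ⟨n, hn, -, h1⟩ := key ε hε
    exact ⟨n, hn, h1⟩

end Growth

end CompactQuantumGroup

theorem corollary3p3 {A : Type u} [CStarAlgebra A] [Nontrivial A] (G : CompactQuantumGroup A)
    (hG : G.DualHasSubexponentialGrowth) (d : ℕ) (U : Matrix (Fin d) (Fin d) A)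
    (hU : G.IsUnitaryRep U) (ρ : Matrix (Fin d) (Fin d) ℂ)
    (hρ : CompactQuantumGroup.IsRho U ρ) :
    HasSymmetricEigenvalues ρ hρ.1.isHermitian := by
  refine Matrix.IsHermitian.eigenvalues₀_eq_of_trace_pow_eq _ _ fun t => ?_
  cases t with
  -- The exponent `0` only compares the sizes of the matrices.
  | zero => rw [pow_zero, pow_zero]
  | succ t =>
    exact CompactQuantumGroup.trace_pow_eq_trace_inv_pow hG hU (hρ.isModular hU.1) t
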